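/- Let $d\ge 1$, $\nu>0$, let $\Omega\subset\mathbb R^d$ be a bounded open convex polygonal (polytopal) domain, $H=L^2(\Omega)$, and let $V=W^{1,2}_0(\Omega)$ (Dirichlet boundary conditions) or $V=W^{1,2}(\Omega)$ (Neumann boundary conditions). Let $A\colon V\to V'$, $\langle Ay,z\rangle_{V',V}=\nu(\nabla y,\nabla z)_{H^d}+(y,z)_H$, and let $V$ be endowed with the norm $\|w\|_V^2=\langle Aw,w\rangle_{V',V}=\nu\|\nabla w\|_{H^d}^2+\|w\|_H^2$; $H$ is identified with a subspace of $V'$ by $\langle h,z\rangle_{V',V}=(h,z)_H$. **Actuators and sensors.** For every $M,S\in\mathbb N_+$ let $U_M=\{1_{\omega^j}\mid 1\le j\le M_\sigma\}$ be the actuators and $W_S=\{1_{\omega_{\rm m}^j}\mid 1\le j\le S_\varsigma\}$ the sensors, given by one of the following patterns. (i) *Chessboard pattern.* $\Omega=\prod_i(a_i,b_i)$ is a box. Divide it into $M^d$ copies of itself rescaled by $1/M$, and each copy into $2^d$ equal sub-boxes, labelled by $e\in\{0,1\}^d$. Each sub-box with $\sum_ie_i$ even contains the support of one actuator, and (in the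 division with $S$ in place of $M$) each sub-box with $\sum_i e_i$ odd contains the support of one sensor. The supports are open boxes whose relative position $\prod_i(\ell_i^e,h_i^e)$, $0\le \ell_i^e<h_i^e\le1$, in the sub-box depends on $e$ only, not on the copy, $M$ or $S$. (For $d=2$ there are $2M^2$ actuators and $2S^2$ sensors.) (ii) *Rescaled copies in a general convex polygonal domain.* $\overline\Omega$ is dissected into finitely many nondegenerate simplices with pairwise disjoint interiors, and each simplex is divided by edgewise (Freudenthal) subdivision into $M^d$ simplices, each of which is a translate of one of at most $d!$ reference simplices rescaled by $1/M$. In each reference simplex a finite nonempty family of pairwise disjoint nonempty open subsets is fixed, and the supports of the actuators in $U_M$ are the correspondingly translated and rescaled copies of these subsets; $W_S$ is built in the same way (with $S$ in place of $M$) from a second choice of subsets. **Operators.** Put $U_M^\diamond v=\sum_jv_j1_{\omega^j}$, $U_M^\vee h=((1_{\omega^j},h)_H)_j$, $[\mathcal V_U]_{(i,j)}=(1_{\omega^j},1_{\omega^i})_H$ and $\mathcal U_M=\operatorname{span}U_M$; define $W_S^\diamond,W_S^\vee,[\mathcal V_W],\mathcal W_S$ in the same way from $W_S$. $P_F^G$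 is the projection in $H$ onto $F$ along $G$, when $H=F\oplus G$. Let $\widetilde{\mathcal U}_M$ be the span in $H$ of auxiliary functions $\Phi^M_j\in V$, $1\le j\le M_\sigma$, with $H=\widetilde{\mathcal U}_M\oplus\mathcal U_M^\perp$ for every $M\in\mathbb N_+$, and let $\widetilde{\mathcal W}_S$ be the span in $H$ of auxiliary functions $\Psi^S_j\in V$, $1\le j\le S_\varsigma$, with $H=\widetilde{\mathcal W}_S\oplus\mathcal W_S^\perp$ for every $S\in\mathbb N_+$. Take $$\text{either}\quad K_M^{[\lambda]}=-\lambda[\mathcal V_U]^{-1}U_M^\vee P_{\mathcal U_M}^{\widetilde{\mathcal U}_M^\perp}P_{\widetilde{\mathcal U}_M}^{\mathcal U_M^\perp}\quad\text{or}\quad K_M^{[\lambda]}=-\lambda[\mathcal V_U]^{-1}U_M^\vee P_{\mathcal U_M}^{\mathcal U_M^\perp},$$ $$\text{either}\quad L_S^{[\lambda]}=-\lambda P_{\mathcal W_S}^{\widetilde{\mathcal W}_S^\perp}P_{\widetilde{\mathcal W}_S}^{\mathcal W_S^\perp}W_S^\diamond[\mathcal V_W]^{-1}\quad\text{or}\quad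 L_S^{[\lambda]}=-\lambda W_S^\diamond[\mathcal V_W]^{-1}.$$ **Claim.** For every $M,S\in\mathbb N_+$ these operators are well defined: the matrices $[\mathcal V_U]$, $[\mathcal V_W]$ are invertible and also $H=\mathcal U_M\oplus\widetilde{\mathcal U}_M^\perp=\mathcal W_S\oplus\widetilde{\mathcal W}_S^\perp$. For every support $\omega$ of an actuator or a sensor, there exist regularized indicator functions, that is, functions $0\ne\varphi\in V$ with $0\le\varphi\le1$ and $\varphi=0$ outside $\omega$, and every choice of one such function for each support gives admissible auxiliary functions. For each of the choices of $K$ and $L$ and every $\varrho>0$: (a) there is $M_*\in\mathbb N_+$ such that for all $M\ge M_*$ there is $\lambda_{1*}=\lambda_{1*}(M)\ge0$ such that for all $\lambda_1\ge\lambda_{1*}$ $$2\langle(A-U_M^\diamond K_M^{[\lambda_1]})w,w\rangle_{V',V}\ge\|w\|_V^2+\varrho\|w\|_H^2\qquad\text{for all }w\in V;$$ (b) there is $S_*\in\mathbb N_+$ such that for all $S\ge S_*$ there is $\lambda_{2*}=\lambda_{2*}(S)\ge0$ such that for all $\lambda_2\ge\lambda_{2*}$ $$2\langle(A-L_S^{[\lambda_2]}W_S^\vee)w,w\rangle_{V',V}\ge\|w\|_V^2+\varrho\|w\|_H^2\qquad\text{for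 all }w\in V.$$ -/

import Mathlib

open MeasureTheory Set

/-! ### The function spaces -/

/-- The Euclidean space `ℝᵈ`. -/
abbrev Eucl (d : ℕ) : Type := EuclideanSpace ℝ (Fin d)

/-- The pivot space `H = L²(Ω)`. -/
abbrev LTwo {d : ℕ} (Ω : Set (Eucl d)) : Type :=
  Lp ℝ 2 ((volume : Measure (Eucl d)).restrict Ω)

/-- Pairs `(y, g)` with `y ∈ L²(Ω)` and `g ∈ L²(Ω)ᵈ`, with the Hilbert product norm. -/
abbrev Jet {d : ℕ} (Ω : Set (Eucl d)) : Type :=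
  WithLp 2 (LTwo Ω × PiLp 2 (fun _ : Fin d => LTwo Ω))

/-- Test functions: smooth functions with compact support in `Ω`. -/
def IsTestFunction {d : ℕ} (Ω : Set (Eucl d)) (φ : Eucl d → ℝ) : Prop :=
  ContDiff ℝ (⊤ : ℕ∞) φ ∧ HasCompactSupport φ ∧ tsupport φ ⊆ Ω

/-- The classical partial derivative `∂φ/∂xᵢ`. -/
noncomputable def partialDeriv {d : ℕ} (i : Fin d) (φ : Eucl d → ℝ) (x : Eucl d) : ℝ :=
  fderiv ℝ φ x (EuclideanSpace.single i 1)

theorem IsTestFunction.integrable_mul {d : ℕ} {Ω : Set (Eucl d)} {φ : Eucl d → ℝ}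
    (hφ : IsTestFunction Ω φ) (f : LTwo Ω) :
    Integrable (fun x => f x * φ x) (volume.restrict Ω) := by
  have h : MemLp φ 2 ((volume : Measure (Eucl d)).restrict Ω) :=
    (hφ.1.continuous.memLp_of_hasCompactSupport hφ.2.1)
  exact MemLp.integrable_mul (p := 2) (q := 2) (Lp.memLp f) h

theorem IsTestFunction.integrable_mul_partialDeriv {d : ℕ} {Ω : Set (Eucl d)} {φ : Eucl d → ℝ}
    (hφ : IsTestFunction Ω φ) (i : Fin d) (f : LTwo Ω) :
    Integrable (fun x => f x * partialDeriv i φ x) (volume.restrict Ω) := by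
  have hc : Continuous (partialDeriv i φ) :=
    (hφ.1.continuous_fderiv (by simp)).clm_apply continuous_const
  have hs : HasCompactSupport (partialDeriv i φ) := by
    refine (hφ.2.1.fderiv (𝕜 := ℝ)).mono ?_
    intro x hx h0
    exact hx (by simp [partialDeriv, h0])
  exact MemLp.integrable_mul (p := 2) (q := 2) (Lp.memLp f) (hc.memLp_of_hasCompactSupport hs)

/-- The Sobolev space `W^{1,2}(Ω)`, as the space of pairs `(y, ∇y)` where `∇y ∈ L²(Ω)ᵈ` is the
weak gradient of `y ∈ L²(Ω)`. -/
def sobolevSpace {d : ℕ} (Ω : Set (Eucl d)) : Submodule ℝ (Jet Ω) where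
  carrier := {p | ∀ φ : Eucl d → ℝ, IsTestFunction Ω φ → ∀ i : Fin d,
    ∫ x in Ω, p.fst x * partialDeriv i φ x = - ∫ x in Ω, p.snd i x * φ x}
  zero_mem' := by
    intro φ _ i
    have h0 : ((0 : LTwo Ω) : Eucl d → ℝ) =ᵐ[volume.restrict Ω] 0 := Lp.coeFn_zero _ _ _
    have h1 : ∀ g : Eucl d → ℝ, ∫ x in Ω, (0 : LTwo Ω) x * g x = 0 := fun g => by
      rw [integral_congr_ae (g := fun _ => (0 : ℝ))
        (by filter_upwards [h0] with x hx; rw [hx, Pi.zero_apply, zero_mul])]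
      simp
    exact (h1 _).trans ((neg_eq_zero.mpr (h1 _)).symm)
  add_mem' := by
    intro p q hp hq φ hφ i
    have h1 : ∀ (f g : LTwo Ω) (ψ : Eucl d → ℝ),
        Integrable (fun x => f x * ψ x) (volume.restrict Ω) →
        Integrable (fun x => g x * ψ x) (volume.restrict Ω) →
        ∫ x in Ω, (f + g : LTwo Ω) x * ψ x = (∫ x in Ω, f x * ψ x) + ∫ x in Ω, g x * ψ x := by
      intro f g ψ hf hg
      rw [← integral_add hf hg]
      refine integral_congr_ae ?_
      filter_upwards [Lp.coeFn_add f g] with x hx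
      rw [hx, Pi.add_apply, add_mul]
    have h2 := h1 p.fst q.fst _ (hφ.integrable_mul_partialDeriv i _)
      (hφ.integrable_mul_partialDeriv i _)
    have h3 := h1 (p.snd i) (q.snd i) _ (hφ.integrable_mul _) (hφ.integrable_mul _)
    simp only [WithLp.add_fst, WithLp.add_snd, PiLp.add_apply]
    rw [h2, h3, hp φ hφ i, hq φ hφ i]
    ring
  smul_mem' := by
    intro c p hp φ hφ i
    have h1 : ∀ (f : LTwo Ω) (ψ : Eucl d → ℝ),
        ∫ x in Ω, (c • f : LTwo Ω) x * ψ x = c * ∫ x in Ω, f x * ψ x := by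
      intro f ψ
      rw [← integral_const_mul]
      refine integral_congr_ae ?_
      filter_upwards [Lp.coeFn_smul c f] with x hx
      simp [hx, mul_assoc]
    simp only [WithLp.smul_fst, WithLp.smul_snd, PiLp.smul_apply]
    rw [h1, h1, hp φ hφ i]
    ring

/-- The elements of `W^{1,2}(Ω)` with zero trace on `∂Ω`: the closure of the test functions in the
`W^{1,2}`-norm. -/
noncomputable def sobolevSpaceZero {d : ℕ} (Ω : Set (Eucl d)) : Submodule ℝ (Jet Ω) :=
  (Submodule.span ℝ {p : Jet Ω | ∃ φ : Eucl d → ℝ, IsTestFunction Ω φ ∧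
    p.fst =ᵐ[volume.restrict Ω] φ ∧
    ∀ i : Fin d, p.snd i =ᵐ[volume.restrict Ω] partialDeriv i φ}).topologicalClosure

/-- The two classical boundary conditions. -/
inductive BoundaryCondition where
  | dirichlet
  | neumann

/-- The space `V` for the given boundary conditions. -/
noncomputable def energySpace {d : ℕ} (Ω : Set (Eucl d)) : BoundaryCondition → Submodule ℝ (Jet Ω)
  | .dirichlet => sobolevSpaceZero Ω
  | .neumann => sobolevSpace Ω

section Operators

variable {d : ℕ} (Ω : Set (Eucl d)) (bc : BoundaryCondition)

/-- The inclusion `V → H`. -/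
noncomputable def inclH : energySpace Ω bc →L[ℝ] LTwo Ω :=
  (WithLp.fstL 2 ℝ (LTwo Ω) (PiLp 2 (fun _ : Fin d => LTwo Ω))).comp (energySpace Ω bc).subtypeL

/-- The weak gradient `V → H^d`. -/
noncomputable def weakGrad : energySpace Ω bc →L[ℝ] PiLp 2 (fun _ : Fin d => LTwo Ω) :=
  (WithLp.sndL 2 ℝ (LTwo Ω) (PiLp 2 (fun _ : Fin d => LTwo Ω))).comp (energySpace Ω bc).subtypeL

/-- The diffusion operator `A : V → V'`, `⟨Ay, z⟩ = ν (∇y, ∇z)_{H^d} + (y, z)_H`. -/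
noncomputable def diffusionOp (ν : ℝ) : energySpace Ω bc →L[ℝ] (energySpace Ω bc →L[ℝ] ℝ) :=
  ν • (isBoundedBilinearMap_inner (𝕜 := ℝ)).toContinuousLinearMap.bilinearComp
      (weakGrad Ω bc) (weakGrad Ω bc) +
    (isBoundedBilinearMap_inner (𝕜 := ℝ)).toContinuousLinearMap.bilinearComp
      (inclH Ω bc) (inclH Ω bc)

theorem diffusionOp_apply (ν : ℝ) (y z : energySpace Ω bc) :
    diffusionOp Ω bc ν y z =
      ν * inner ℝ (weakGrad Ω bc y) (weakGrad Ω bc z) +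
        inner ℝ (inclH Ω bc y) (inclH Ω bc z) := rfl

/-- The square of the norm of `V`, the norm associated with the scalar product `⟨A·, ·⟩`:
`‖w‖_V² = ν ‖∇w‖²_{H^d} + ‖w‖²_H`. -/
noncomputable def sqNormV (ν : ℝ) (w : energySpace Ω bc) : ℝ :=
  ν * ‖weakGrad Ω bc w‖ ^ 2 + ‖inclH Ω bc w‖ ^ 2

/-- The inclusion `H → V'` of the pivot space, `⟨h, z⟩ = (h, z)_H`. -/
noncomputable def pivot (h : LTwo Ω) : energySpace Ω bc →L[ℝ] ℝ :=
  (innerSL ℝ h).comp (inclH Ω bc)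

open Classical in
/-- The class in `L²(Ω)` of the indicator function `1_ω` (for open `ω` and bounded `Ω` it is square
integrable, so that the first branch applies). -/
noncomputable def indicatorL2 (ω : Set (Eucl d)) : LTwo Ω :=
  if h : MemLp (ω.indicator (fun _ => (1 : ℝ))) 2 ((volume : Measure (Eucl d)).restrict Ω) then
    h.toLp _
  else 0

open Classical in
/-- The projection `P_F^G` in `H` onto `F` along `G`, defined if `H = F ⊕ G`. -/
noncomputable def obliqueProj (F G : Submodule ℝ (LTwo Ω)) : LTwo Ω →ₗ[ℝ] LTwo Ω :=
  if h : IsCompl F G then F.projection G h else 0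

variable {ι : Type} [Fintype ι]

/-- The span of the indicator functions of a family of sets. -/
noncomputable def deviceSpan (ω : ι → Set (Eucl d)) : Submodule ℝ (LTwo Ω) :=
  Submodule.span ℝ (range fun j => indicatorL2 Ω (ω j))

/-- The operator `U^⋄ : v ↦ ∑ⱼ vⱼ 1_{ωʲ}`. -/
noncomputable def diamondOp (ω : ι → Set (Eucl d)) : (ι → ℝ) →ₗ[ℝ] LTwo Ω :=
  Fintype.linearCombination ℝ (fun j => indicatorL2 Ω (ω j))

/-- The operator `U^∨ : h ↦ ((1_{ωʲ}, h)_H)ⱼ`. -/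
noncomputable def veeOp (ω : ι → Set (Eucl d)) : LTwo Ω →ₗ[ℝ] (ι → ℝ) :=
  LinearMap.pi (fun j => (innerSL ℝ (indicatorL2 Ω (ω j))).toLinearMap)

/-- The matrix `[𝒱]` with entries `(1_{ωʲ}, 1_{ωⁱ})_H`. -/
noncomputable def gram (ω : ι → Set (Eucl d)) : Matrix ι ι ℝ :=
  Matrix.of fun i j => inner ℝ (indicatorL2 Ω (ω j)) (indicatorL2 Ω (ω i))

open Classical in
/-- The linear map of the inverse matrix `[𝒱]⁻¹`. -/
noncomputable def gramInv (ω : ι → Set (Eucl d)) : (ι → ℝ) →ₗ[ℝ] (ι → ℝ) :=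
  Matrix.toLin' (gram Ω ω)⁻¹

variable {bc} in
/-- The span in `H` of a family of auxiliary functions in `V`. -/
noncomputable def auxSpan (Φ : ι → energySpace Ω bc) : Submodule ℝ (LTwo Ω) :=
  Submodule.span ℝ (range fun j => inclH Ω bc (Φ j))

/-- `K^{[λ]} = -λ [𝒱]⁻¹ U^∨ P_𝒰^{𝒰~^⊥} P_{𝒰~}^{𝒰^⊥}`, where `𝒰~` is the auxiliary space `F`. -/
noncomputable def obliqueFeedback (ω : ι → Set (Eucl d)) (F : Submodule ℝ (LTwo Ω)) (lam : ℝ) :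
    LTwo Ω →ₗ[ℝ] (ι → ℝ) :=
  -lam • (gramInv Ω ω ∘ₗ veeOp Ω ω ∘ₗ obliqueProj Ω (deviceSpan Ω ω) Fᗮ ∘ₗ
    obliqueProj Ω F (deviceSpan Ω ω)ᗮ)

/-- `K^{[λ]} = -λ [𝒱]⁻¹ U^∨ P_𝒰^{𝒰^⊥}`. -/
noncomputable def orthogonalFeedback (ω : ι → Set (Eucl d)) (lam : ℝ) :
    LTwo Ω →ₗ[ℝ] (ι → ℝ) :=
  -lam • (gramInv Ω ω ∘ₗ veeOp Ω ω ∘ₗ obliqueProj Ω (deviceSpan Ω ω) (deviceSpan Ω ω)ᗮ)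

/-- `L^{[λ]} = -λ P_𝒲^{𝒲~^⊥} P_{𝒲~}^{𝒲^⊥} W^⋄ [𝒱]⁻¹`, where `𝒲~` is the auxiliary space `F`. -/
noncomputable def obliqueInjection (ω : ι → Set (Eucl d)) (F : Submodule ℝ (LTwo Ω)) (lam : ℝ) :
    (ι → ℝ) →ₗ[ℝ] LTwo Ω :=
  -lam • (obliqueProj Ω (deviceSpan Ω ω) Fᗮ ∘ₗ obliqueProj Ω F (deviceSpan Ω ω)ᗮ ∘ₗ
    diamondOp Ω ω ∘ₗ gramInv Ω ω)

/-- `L^{[λ]} = -λ W^⋄ [𝒱]⁻¹`. -/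
noncomputable def orthogonalInjection (ω : ι → Set (Eucl d)) (lam : ℝ) :
    (ι → ℝ) →ₗ[ℝ] LTwo Ω :=
  -lam • (diamondOp Ω ω ∘ₗ gramInv Ω ω)

/-- A regularized indicator function of `ω`: a nonzero element of `V` with values in `[0, 1]` that
vanishes outside `ω`. -/
def IsRegularizedIndicator (ω : Set (Eucl d)) (φ : energySpace Ω bc) : Prop :=
  (∀ᵐ x ∂(volume.restrict Ω), inclH Ω bc φ x ∈ Icc (0 : ℝ) 1 ∧ (x ∉ ω → inclH Ω bc φ x = 0)) ∧
    inclH Ω bc φ ≠ 0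

end Operators

/-! ### The assumption on the feedback-input and output-injection operators -/

section Assumption

variable {d : ℕ} (Ω : Set (Eucl d)) (bc : BoundaryCondition) (ν : ℝ)
  {ι κ : ℕ → Type} [∀ M, Fintype (ι M)] [∀ S, Fintype (κ S)]

/-- The assumption on the families `K` (input feedback, for the actuators `ω`) and `L` (output
injection, for the sensors `ωm`). -/
def FeedbackInjectionAssumption (ω : ∀ M, ι M → Set (Eucl d)) (ωm : ∀ S, κ S → Set (Eucl d))
    (K : ∀ M, ℝ → LTwo Ω →ₗ[ℝ] (ι M → ℝ)) (L : ∀ S, ℝ → (κ S → ℝ) →ₗ[ℝ] LTwo Ω) : Prop :=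
  ∀ ϱ : ℝ, 0 < ϱ →
    (∃ Mstar : ℕ, 1 ≤ Mstar ∧ ∀ M, Mstar ≤ M → ∃ lamStar : ℝ, 0 ≤ lamStar ∧
      ∀ lam : ℝ, lamStar ≤ lam → ∀ w : energySpace Ω bc,
        sqNormV Ω bc ν w + ϱ * ‖inclH Ω bc w‖ ^ 2 ≤
          2 * (diffusionOp Ω bc ν w -
            pivot Ω bc (diamondOp Ω (ω M) (K M lam (inclH Ω bc w)))) w) ∧
    (∃ Sstar : ℕ, 1 ≤ Sstar ∧ ∀ S, Sstar ≤ S → ∃ lamStar : ℝ, 0 ≤ lamStar ∧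
      ∀ lam : ℝ, lamStar ≤ lam → ∀ w : energySpace Ω bc,
        sqNormV Ω bc ν w + ϱ * ‖inclH Ω bc w‖ ^ 2 ≤
          2 * (diffusionOp Ω bc ν w -
            pivot Ω bc (L S lam (veeOp Ω (ωm S) (inclH Ω bc w)))) w)

/-- The families `Φ M = {Φⱼ} ⊂ V` are auxiliary functions for the devices `ω M`:
`H = span Φ M ⊕ (span {1_{ωʲ}})^⊥`. -/
def IsAuxiliary (ω : ∀ M, ι M → Set (Eucl d)) (Φ : ∀ M, ι M → energySpace Ω bc) : Prop :=
  ∀ M, 1 ≤ M → IsCompl (auxSpan Ω (Φ M)) (deviceSpan Ω (ω M))ᗮ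

open Classical in
/-- The operators built from the devices `ω` are well defined: the matrices `[𝒱]` are invertible,
the projections onto `𝒰` along `𝒰~^⊥` exist for all auxiliary functions, regularized indicator
functions exist, and they are auxiliary functions. -/
def WellPosedDevices (ω : ∀ M, ι M → Set (Eucl d)) : Prop :=
  (∀ M, 1 ≤ M → IsUnit (gram Ω (ω M)).det) ∧
  (∀ Φ : ∀ M, ι M → energySpace Ω bc, IsAuxiliary Ω bc ω Φ →
    ∀ M, 1 ≤ M → IsCompl (deviceSpan Ω (ω M)) (auxSpan Ω (Φ M))ᗮ) ∧
  (∀ M, 1 ≤ M → ∀ j, ∃ φ : energySpace Ω bc, IsRegularizedIndicator Ω bc (ω M j) φ) ∧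
  (∀ Φ : ∀ M, ι M → energySpace Ω bc,
    (∀ M, 1 ≤ M → ∀ j, IsRegularizedIndicator Ω bc (ω M j) (Φ M j)) → IsAuxiliary Ω bc ω Φ)

/-- The explicit operators for the actuators `ω` and the sensors `ωm` are well defined, and each of
the two choices of `K` together with each of the two choices of `L` satisfies the assumption. -/
def ExplicitOperatorsSatisfyAssumption
    (ω : ∀ M, ι M → Set (Eucl d)) (ωm : ∀ S, κ S → Set (Eucl d)) : Prop :=
  WellPosedDevices Ω bc ω ∧ WellPosedDevices Ω bc ωm ∧
  ∀ (Φ : ∀ M, ι M → energySpace Ω bc) (Ψ : ∀ S, κ S → energySpace Ω bc),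
    IsAuxiliary Ω bc ω Φ → IsAuxiliary Ω bc ωm Ψ →
    ∀ (K : ∀ M, ℝ → LTwo Ω →ₗ[ℝ] (ι M → ℝ)) (L : ∀ S, ℝ → (κ S → ℝ) →ₗ[ℝ] LTwo Ω),
      (K = (fun M lam => obliqueFeedback Ω (ω M) (auxSpan Ω (Φ M)) lam) ∨
        K = (fun M lam => orthogonalFeedback Ω (ω M) lam)) →
      (L = (fun S lam => obliqueInjection Ω (ωm S) (auxSpan Ω (Ψ S)) lam) ∨
        L = (fun S lam => orthogonalInjection Ω (ωm S) lam)) →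
      FeedbackInjectionAssumption Ω bc ν ω ωm K L

end Assumption

/-! ### The chessboard pattern in a rectangle -/

/-- The open rectangle (box) `∏ᵢ (aᵢ, bᵢ)`. -/
def openRect {d : ℕ} (a b : Fin d → ℝ) : Set (Eucl d) := {x | ∀ i, x i ∈ Ioo (a i) (b i)}

/-- A chessboard square of the `M`-th pattern: the position `z` of the rescaled copy, one of `Mᵈ`,
and the position `e ∈ {0,1}ᵈ` of the square in the copy, where the parity of `e` (`0` for the squares
of the colour of the corner square at `a`, `1` for the other ones) is prescribed. -/
abbrev ChessIndex (d M : ℕ) (parity : ℕ) : Type :=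
  (Fin d → Fin M) × {e : Fin d → Fin 2 // (∑ i, (e i : ℕ)) % 2 = parity}

/-- The position of a device in each of the `2ᵈ` chessboard squares of the reference pattern, in
relative coordinates of the square: the box `∏ᵢ (loᵢ, hiᵢ) ⊆ (0,1)ᵈ`. -/
structure ChessPlacement (d : ℕ) where
  lo : (Fin d → Fin 2) → Fin d → ℝ
  hi : (Fin d → Fin 2) → Fin d → ℝ
  lo_nonneg : ∀ e i, 0 ≤ lo e i
  lo_lt_hi : ∀ e i, lo e i < hi e i
  hi_le_one : ∀ e i, hi e i ≤ 1

/-- The supports of the `M`-th pattern in the squares of the given parity: the rectangle is divided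
into `Mᵈ` copies, rescaled by `1/M`, each copy is divided into `2ᵈ` squares, and the support is the
box with the prescribed relative position in the square. -/
def chessSupport {d : ℕ} (a b : Fin d → ℝ) (p : ChessPlacement d) (parity M : ℕ)
    (c : ChessIndex d M parity) : Set (Eucl d) :=
  {x | ∀ i, x i ∈ Ioo
    (a i + (b i - a i) / M * ((c.1 i : ℝ) + ((c.2.1 i : ℝ) + p.lo c.2.1 i) / 2))
    (a i + (b i - a i) / M * ((c.1 i : ℝ) + ((c.2.1 i : ℝ) + p.hi c.2.1 i) / 2))}

/-! ### Rescaled copies in a general convex polygonal domain -/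

/-- Open convex polygonal (polyhedral, polytopal) domains. -/
def IsConvexPolytopalDomain {d : ℕ} (Ω : Set (Eucl d)) : Prop :=
  Ω.Nonempty ∧ ∃ s : Finset (Eucl d), Ω = interior (convexHull ℝ (s : Set (Eucl d)))

/-- A dissection of the closure of `Ω` into finitely many nondegenerate simplices. -/
structure SimplicialDissection {d : ℕ} (Ω : Set (Eucl d)) where
  /-- the number of simplices -/
  n : ℕ
  /-- the vertices of the simplices -/
  vertex : Fin n → Fin (d + 1) → Eucl d
  affineIndependent : ∀ k, AffineIndependent ℝ (vertex k)
  interior_disjoint : Pairwise fun k l =>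
    Disjoint (interior (convexHull ℝ (range (vertex k))))
      (interior (convexHull ℝ (range (vertex l))))
  iUnion_eq : ⋃ k, convexHull ℝ (range (vertex k)) = closure Ω

/-- The Kuhn simplex `{x | 1 > x_{π 0} > x_{π 1} > ⋯ > x_{π (d-1)} > 0}` of a permutation `π`. -/
def kuhnSimplex {d : ℕ} (π : Equiv.Perm (Fin d)) : Set (Fin d → ℝ) :=
  {x | (∀ i, x i ∈ Ioo (0 : ℝ) 1) ∧ ∀ i j, i < j → x (π j) < x (π i)}

/-- The linear map `x ↦ ∑ᵢ xᵢ (v_{i+1} - vᵢ)`: followed by the translation by `v₀`, it maps the Kuhn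
simplex of the identity onto the interior of the simplex with vertices `v₀, …, v_d`. -/
def edgeMap {d : ℕ} (v : Fin (d + 1) → Eucl d) (x : Fin d → ℝ) : Eucl d :=
  ∑ i, x i • (v i.succ - v i.castSucc)

/-- The cells of the edgewise (Freudenthal) subdivision of a simplex into `Mᵈ` simplices, each a
translate of one of at most `d!` simplices rescaled by `1/M`: in Kuhn coordinates, these are the
Kuhn simplices `(z + kuhnSimplex π) / M` of the grid of mesh size `1/M` that are contained in the
Kuhn simplex of the identity. -/
abbrev EdgewiseCell (d M : ℕ) : Type :=
  {c : (Fin d → Fin M) × Equiv.Perm (Fin d) //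
    ∀ x ∈ kuhnSimplex c.2, (fun i => ((c.1 i : ℝ) + x i) / M) ∈ kuhnSimplex (Equiv.refl (Fin d))}

/-- A reference pattern of devices: for each simplex `k` of the dissection and each of the reference
cells `edgeMap (v k) '' kuhnSimplex π`, finitely many (at least one) pairwise disjoint nonempty open
subsets of the cell. -/
structure ReferencePattern {d : ℕ} {Ω : Set (Eucl d)} (T : SimplicialDissection Ω) where
  count : Fin T.n → Equiv.Perm (Fin d) → ℕ
  supp : ∀ k π, Fin (count k π) → Set (Eucl d)
  count_pos : ∀ k π, 0 < count k π
  isOpen : ∀ k π j, IsOpen (supp k π j)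
  nonempty : ∀ k π j, (supp k π j).Nonempty
  subset_cell : ∀ k π j, supp k π j ⊆ edgeMap (T.vertex k) '' kuhnSimplex π
  disjoint : ∀ k π, Pairwise fun i j => Disjoint (supp k π i) (supp k π j)

/-- The devices of the `M`-th rescaled pattern: a simplex, a cell of its edgewise subdivision, and a
device of the reference pattern of that cell. -/
abbrev ReferencePattern.Index {d : ℕ} {Ω : Set (Eucl d)} {T : SimplicialDissection Ω}
    (P : ReferencePattern T) (M : ℕ) : Type :=
  Σ c : Fin T.n × EdgewiseCell d M, Fin (P.count c.1 c.2.1.2)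

noncomputable instance (d M : ℕ) : Fintype (EdgewiseCell d M) := Fintype.ofFinite _

noncomputable instance {d : ℕ} {Ω : Set (Eucl d)} {T : SimplicialDissection Ω}
    (P : ReferencePattern T) (M : ℕ) : Fintype (P.Index M) :=
  Sigma.instFintype

/-- The supports of the `M`-th rescaled pattern: in the cell `(z, π)` of the simplex with vertices
`v₀, …, v_d`, the reference support rescaled by `1/M` and moved to the position of the cell. -/
def ReferencePattern.support {d : ℕ} {Ω : Set (Eucl d)} {T : SimplicialDissection Ω}
    (P : ReferencePattern T) (M : ℕ) (c : P.Index M) : Set (Eucl d) :=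
  (fun x => T.vertex c.1.1 0 +
    (M : ℝ)⁻¹ • (edgeMap (T.vertex c.1.1) (fun i => ((c.1.2.1.1 i : ℕ) : ℝ)) + x)) ''
    P.supp c.1.1 c.1.2.1.2 c.2

/-! ### Square integrable functions and test functions -/

/-! Since `2⟨Aw,w⟩ = 2‖w‖_V²`, both claims say that `ϱ‖w‖_H² ≤ ‖w‖_V² - 2(Bw,w)_H`, where `B` is
`U^⋄K` or `LW^∨`. For the orthogonal choices `-(Bw,w) = λ‖Pw‖²`, with `P` the orthogonal projection
onto the span of the devices. For the oblique choices `-(Bw,w) = λ‖qw‖²`, with `q` the projection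
onto the auxiliary space along the orthogonal complement of the devices, and `‖Pw‖ ≤ ‖qw‖`. So one
estimate serves all four operators.

That estimate is a Poincaré inequality with averages over the devices, `‖w‖² ≤ κ (D²/M² ‖∇w‖² +
2‖Pw‖²)`, with `κ` independent of `M` (`HasConvexCells.sq_norm_inclH_le`). Choosing `M` with
`ϱκD²/M² ≤ ν` and `λ ≥ ϱκ` finishes the argument.

The inequality is summed over convex cells of diameter at most `D/M`, each containing a device of
volume at least `c/M^d`. On one convex cell it follows from a translation estimate, proved by
duality against test functions and integrated over all translations
(`HasWeakGradient.integral_sq_le`). No compactness, extension operator or boundary condition enters,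
and the constants scale explicitly.

It remains to exhibit the cells: subboxes for the chessboard, and for the simplicial patterns the
cells of the edgewise subdivision, described in coordinates where they are Kuhn simplices of a cubic
grid. -/

theorem MeasureTheory.MemLp.norm_toLp_two_sq {α : Type*} [MeasurableSpace α] {μ : Measure α}
    {f : α → ℝ} (hf : MemLp f 2 μ) : ‖hf.toLp f‖ ^ 2 = ∫ x, f x ^ 2 ∂μ := by
  rw [← real_inner_self_eq_norm_sq, L2.inner_def]
  refine integral_congr_ae ?_
  filter_upwards [hf.coeFn_toLp] with x hx
  simp [hx, sq]

theorem MeasureTheory.MemLp.inner_toLp_two {α : Type*} [MeasurableSpace α] {μ : Measure α}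
    {f g : α → ℝ} (hf : MemLp f 2 μ) (hg : MemLp g 2 μ) :
    inner ℝ (hf.toLp f) (hg.toLp g) = ∫ x, f x * g x ∂μ := by
  rw [L2.inner_def]
  refine integral_congr_ae ?_
  filter_upwards [hf.coeFn_toLp, hg.coeFn_toLp] with x hx hy
  simp [hx, hy, mul_comm]

theorem MeasureTheory.MemLp.abs_integral_mul_le {α : Type*} [MeasurableSpace α] {μ : Measure α}
    {f g : α → ℝ} (hf : MemLp f 2 μ) (hg : MemLp g 2 μ) :
    |∫ x, f x * g x ∂μ| ≤ √(∫ x, f x ^ 2 ∂μ) * √(∫ x, g x ^ 2 ∂μ) := by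
  rw [← hf.inner_toLp_two hg, ← hf.norm_toLp_two_sq, ← hg.norm_toLp_two_sq,
    Real.sqrt_sq (norm_nonneg _), Real.sqrt_sq (norm_nonneg _)]
  exact abs_real_inner_le_norm _ _

section TestFunctions

variable {d : ℕ} {C D : Set (Eucl d)} {φ ψ : Eucl d → ℝ}

theorem IsTestFunction.mono (h : IsTestFunction D φ) (hDC : D ⊆ C) : IsTestFunction C φ :=
  ⟨h.1, h.2.1, h.2.2.trans hDC⟩

theorem IsTestFunction.zero : IsTestFunction C (0 : Eucl d → ℝ) :=
  ⟨contDiff_const, HasCompactSupport.zero, by simp [tsupport]⟩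

theorem IsTestFunction.add (h : IsTestFunction C φ) (h' : IsTestFunction C ψ) :
    IsTestFunction C (φ + ψ) :=
  ⟨h.1.add h'.1, h.2.1.add h'.2.1, (tsupport_add _ _).trans (union_subset h.2.2 h'.2.2)⟩

theorem IsTestFunction.const_smul (h : IsTestFunction C φ) (c : ℝ) :
    IsTestFunction C (c • φ) :=
  ⟨h.1.const_smul c, h.2.1.smul_left (f := fun _ => c),
    (tsupport_smul_subset_right (fun _ => c) φ).trans h.2.2⟩

theorem IsTestFunction.memLp (h : IsTestFunction C φ) (μ : Measure (Eucl d))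
    [IsFiniteMeasureOnCompacts μ] : MemLp φ 2 μ :=
  h.1.continuous.memLp_of_hasCompactSupport h.2.1

theorem IsTestFunction.continuous_partialDeriv (h : IsTestFunction C φ) (i : Fin d) :
    Continuous (partialDeriv i φ) :=
  (h.1.continuous_fderiv (by simp)).clm_apply continuous_const

theorem IsTestFunction.hasCompactSupport_partialDeriv (h : IsTestFunction C φ) (i : Fin d) :
    HasCompactSupport (partialDeriv i φ) := by
  refine (h.2.1.fderiv (𝕜 := ℝ)).mono ?_
  intro x hx h0
  exact hx (by simp [partialDeriv, h0])

theorem IsTestFunction.memLp_partialDeriv (h : IsTestFunction C φ) (i : Fin d)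
    (μ : Measure (Eucl d)) [IsFiniteMeasureOnCompacts μ] : MemLp (partialDeriv i φ) 2 μ :=
  (h.continuous_partialDeriv i).memLp_of_hasCompactSupport (h.hasCompactSupport_partialDeriv i)

theorem IsTestFunction.eq_zero_of_notMem (h : IsTestFunction C φ) {x : Eucl d} (hx : x ∉ C) :
    φ x = 0 :=
  image_eq_zero_of_notMem_tsupport fun hx' => hx (h.2.2 hx')

theorem IsTestFunction.comp_sub (h : IsTestFunction C φ) (v : Eucl d)
    (hv : ∀ x ∈ C, x + v ∈ D) : IsTestFunction D (fun x => φ (x - v)) := by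
  have ht : tsupport (fun x => φ (x - v)) = (fun x => x - v) ⁻¹' tsupport φ := by
    exact (tsupport_comp_eq_preimage φ (Homeomorph.subRight v))
  refine ⟨h.1.comp (contDiff_id.sub contDiff_const),
    h.2.1.comp_homeomorph (Homeomorph.subRight v), ?_⟩
  rw [ht]
  intro x hx
  simpa using hv _ (h.2.2 hx)

theorem partialDeriv_comp_sub (i : Fin d) (φ : Eucl d → ℝ) (v x : Eucl d) :
    partialDeriv i (fun x => φ (x - v)) x = partialDeriv i φ (x - v) := by
  rw [partialDeriv, partialDeriv, fderiv_comp_sub]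

theorem fderiv_apply_eq_sum_partialDeriv (φ : Eucl d → ℝ) (x v : Eucl d) :
    fderiv ℝ φ x v = ∑ i, v i * partialDeriv i φ x := by
  have hv : v = ∑ i, v i • EuclideanSpace.single i (1 : ℝ) := by
    ext j
    simp [Finset.sum_apply, Pi.single_apply]
  conv_lhs => rw [hv]
  simp [partialDeriv]

/-- The classes of the test functions in `L²(D)`. -/
def testClasses (D : Set (Eucl d)) : Submodule ℝ (LTwo D) where
  carrier := {f | ∃ φ, IsTestFunction D φ ∧ f =ᵐ[volume.restrict D] φ}
  zero_mem' := ⟨0, .zero, Lp.coeFn_zero _ _ _⟩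
  add_mem' := by
    rintro f g ⟨φ, hφ, hf⟩ ⟨ψ, hψ, hg⟩
    exact ⟨φ + ψ, hφ.add hψ, (Lp.coeFn_add f g).trans (hf.add hg)⟩
  smul_mem' := by
    rintro c f ⟨φ, hφ, hf⟩
    exact ⟨c • φ, hφ.const_smul c, (Lp.coeFn_smul c f).trans (hf.const_smul c)⟩

/-- An element orthogonal to all test functions vanishes a.e. by the fundamental lemma of the
calculus of variations, so the orthogonal complement is trivial. -/
theorem testClasses_topologicalClosure (hD : IsOpen D) :
    (testClasses D).topologicalClosure = ⊤ := by
  rw [Submodule.topologicalClosure_eq_top_iff, Submodule.eq_bot_iff]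
  intro f hf
  rw [Submodule.mem_orthogonal] at hf
  rw [Lp.eq_zero_iff_ae_eq_zero, Filter.EventuallyEq]
  have hloc : LocallyIntegrableOn f D (volume : Measure (Eucl d)) := by
    refine (locallyIntegrableOn_iff hD.isLocallyClosed).2 fun k hk hkc => ?_
    have : MemLp f 2 (volume.restrict k) :=
      (Lp.memLp f).mono_measure (Measure.restrict_mono hk le_rfl)
    have hfin : IsFiniteMeasure (volume.restrict k) :=
      ⟨by simpa using hkc.measure_lt_top⟩
    exact this.integrable (by norm_num)
  have := hD.ae_eq_zero_of_integral_contDiff_smul_eq_zero hloc fun g hg hgc hgs => ?_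
  · rw [ae_restrict_iff' hD.measurableSet]
    exact this
  · have ht : IsTestFunction D g := ⟨hg, hgc, hgs⟩
    have h0 := hf ((ht.memLp _).toLp g) ⟨g, ht, (ht.memLp _).coeFn_toLp⟩
    rw [L2.inner_def] at h0
    rw [← setIntegral_eq_integral_of_forall_compl_eq_zero (s := D), ← h0]
    · refine integral_congr_ae ?_
      filter_upwards [(ht.memLp (volume.restrict D)).coeFn_toLp] with x hx
      simp [hx, mul_comm]
    · intro x hx
      simp [ht.eq_zero_of_notMem hx]

/-- A function is bounded in `L²(D)` by its bound as a functional on test functions. -/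
theorem integral_sq_le_of_test (hD : IsOpen D) {F : Eucl d → ℝ}
    (hF : MemLp F 2 (volume.restrict D)) {K : ℝ} (hK : 0 ≤ K)
    (h : ∀ φ, IsTestFunction D φ → |∫ x in D, F x * φ x| ≤ K * √(∫ x in D, φ x ^ 2)) :
    ∫ x in D, F x ^ 2 ≤ K ^ 2 := by
  -- The bound passes from test functions to all of `L²(D)` by density; it is then applied to `F`
  -- itself.
  have key : ∀ f : LTwo D, |inner ℝ (hF.toLp F) f| ≤ K * ‖f‖ := by
    have hcl : IsClosed {f : LTwo D | |inner ℝ (hF.toLp F) f| ≤ K * ‖f‖} :=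
      isClosed_le (by fun_prop) (by fun_prop)
    have hsub : (testClasses D : Set (LTwo D)) ⊆
        {f : LTwo D | |inner ℝ (hF.toLp F) f| ≤ K * ‖f‖} := by
      rintro f ⟨φ, hφ, hf⟩
      have hf' : f = (hφ.memLp _).toLp φ := by
        apply Lp.ext
        exact hf.trans (hφ.memLp _).coeFn_toLp.symm
      have := h φ hφ
      rw [← (hφ.memLp _).norm_toLp_two_sq, Real.sqrt_sq (norm_nonneg _),
        ← hF.inner_toLp_two (hφ.memLp _), ← hf'] at this
      exact this
    intro f
    have hf : f ∈ (testClasses D).topologicalClosure := by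
      rw [testClasses_topologicalClosure hD]; trivial
    exact closure_minimal hsub hcl hf
  have h1 := (le_abs_self _).trans (key (hF.toLp F))
  rw [real_inner_self_eq_norm_sq] at h1
  rw [← hF.norm_toLp_two_sq]
  have h2 : ‖hF.toLp F‖ ≤ K := by
    by_contra! hc
    nlinarith [norm_nonneg (hF.toLp F)]
  exact pow_le_pow_left₀ (norm_nonneg _) h2 2

end TestFunctions

/-! ### Translation estimates from a weak gradient. -/

section Translation

variable {d : ℕ} {C : Set (Eucl d)} {y : Eucl d → ℝ} {g : Fin d → Eucl d → ℝ}

/-- `g` is a weak gradient of `y` in `C`. -/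
def HasWeakGradient (C : Set (Eucl d)) (y : Eucl d → ℝ) (g : Fin d → Eucl d → ℝ) : Prop :=
  ∀ φ : Eucl d → ℝ, IsTestFunction C φ → ∀ i : Fin d,
    ∫ x in C, y x * partialDeriv i φ x = - ∫ x in C, g i x * φ x

/-- Under the integral the derivative falls on the smooth factor and gives `-h · ∇φ(x - t h)`. By
`ht` the translate is still a test function in `C`, so the weak gradient moves the derivative onto
`y`. -/
theorem HasWeakGradient.hasDerivAt_integral_translate (hC : volume C ≠ ⊤)
    (hy : MemLp y 2 (volume.restrict C)) (hyg : HasWeakGradient C y g) {D : Set (Eucl d)} {φ : Eucl d → ℝ} (hφ : IsTestFunction D φ)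
    (h : Eucl d) {t : ℝ} (ht : ∀ x ∈ D, x + t • h ∈ C) :
    HasDerivAt (fun t : ℝ => ∫ x in C, y x * φ (x - t • h))
      (∑ i, h i * ∫ x in C, g i x * φ (x - t • h)) t := by
  have hfin : IsFiniteMeasure (volume.restrict C) := ⟨by simpa using hC.lt_top⟩
  have hdc : Continuous (fderiv ℝ φ) := hφ.1.continuous_fderiv (by simp)
  obtain ⟨B, hB⟩ : ∃ B, ∀ x, ‖fderiv ℝ φ x‖ ≤ B :=
    hdc.bounded_above_of_compact_support (hφ.2.1.fderiv (𝕜 := ℝ))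
  have hcont : ∀ s : ℝ, Continuous fun x : Eucl d => φ (x - s • h) := fun s =>
    hφ.1.continuous.comp (by fun_prop)
  have key := hasDerivAt_integral_of_dominated_loc_of_deriv_le (μ := volume.restrict C)
    (F := fun (t : ℝ) x => y x * φ (x - t • h))
    (F' := fun (t : ℝ) x => y x * (fderiv ℝ φ (x - t • h) (-h)))
    (bound := fun x => |y x| * (B * ‖h‖)) (x₀ := t) (s := univ) Filter.univ_mem
    (Filter.Eventually.of_forall fun s => hy.1.mul (hcont s).aestronglyMeasurable)
    ?_ ?_ ?_ ?_ ?_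
  · suffices heq : ∑ i, h i * ∫ x in C, g i x * φ (x - t • h) =
        ∫ x in C, y x * (fderiv ℝ φ (x - t • h) (-h)) by
      rw [heq]; exact key.2
    have hφt : IsTestFunction C (fun x => φ (x - t • h)) := hφ.comp_sub _ ht
    have : ∀ i, h i * ∫ x in C, g i x * φ (x - t • h) =
        ∫ x in C, y x * (-(h i) * partialDeriv i φ (x - t • h)) := by
      intro i
      have h1 : ∫ x in C, y x * partialDeriv i φ (x - t • h) =
          -∫ x in C, g i x * φ (x - t • h) :=
        (integral_congr_ae (Filter.Eventually.of_forall fun x =>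
          congrArg (y x * ·) (partialDeriv_comp_sub i φ (t • h) x).symm)).trans (hyg _ hφt i)
      rw [← neg_neg (∫ x in C, g i x * φ (x - t • h)), ← h1, mul_neg, ← neg_mul,
        ← integral_const_mul]
      congr 1; ext x; ring
    rw [Finset.sum_congr rfl fun i _ => this i, ← integral_finsetSum]
    · congr 1; ext x
      rw [fderiv_apply_eq_sum_partialDeriv, Finset.mul_sum]
      simp
    · intro i _
      have := hy.integrable_mul (hφt.memLp_partialDeriv i (volume.restrict C))
      refine (this.const_mul (-(h i))).congr (Filter.Eventually.of_forall fun x => ?_)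
      have h2 := partialDeriv_comp_sub i φ (t • h) x
      simp only [Pi.mul_apply]
      rw [← h2]; ring
  · exact hy.integrable_mul ((hφ.comp_sub (D := univ) (t • h) (fun _ _ => trivial)).memLp _)
  · exact hy.1.mul ((hdc.comp (by fun_prop : Continuous fun x : Eucl d => x - t • h)).clm_apply
      continuous_const).aestronglyMeasurable
  · refine Filter.Eventually.of_forall fun x s _ => ?_
    rw [norm_mul, Real.norm_eq_abs (y x)]
    refine mul_le_mul_of_nonneg_left ?_ (abs_nonneg _)
    refine ((fderiv ℝ φ (x - s • h)).le_opNorm _).trans ?_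
    rw [norm_neg]
    exact mul_le_mul_of_nonneg_right (hB _) (norm_nonneg _)
  · exact ((hy.integrable (by norm_num)).abs).mul_const _
  · refine Filter.Eventually.of_forall fun x s _ => ?_
    refine HasDerivAt.const_mul _ ?_
    have h1 : HasDerivAt (fun s : ℝ => x - s • h) (-h) s := by
      simpa using ((hasDerivAt_id s).smul_const h).const_sub x
    exact ((hφ.1.differentiable (by simp) _).hasFDerivAt.comp_hasDerivAt s h1)

theorem abs_sum_mul_integral_le (hg : ∀ i, MemLp (g i) 2 (volume.restrict C)) {φ : Eucl d → ℝ}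
    (hφ : MemLp φ 2 (volume.restrict C)) (h : Eucl d) :
    |∑ i, h i * ∫ x in C, g i x * φ x| ≤
      ‖h‖ * √(∑ i, ∫ x in C, g i x ^ 2) * √(∫ x in C, φ x ^ 2) := by
  have h1 : |∑ i, h i * ∫ x in C, g i x * φ x| ≤
      ∑ i, (|h i| * (√(∫ x in C, g i x ^ 2) * √(∫ x in C, φ x ^ 2))) := by
    refine (Finset.abs_sum_le_sum_abs _ _).trans (Finset.sum_le_sum fun i _ => ?_)
    rw [abs_mul]
    exact mul_le_mul_of_nonneg_left ((hg i).abs_integral_mul_le hφ) (abs_nonneg _)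
  refine h1.trans ?_
  simp_rw [← mul_assoc]
  rw [← Finset.sum_mul]
  refine mul_le_mul_of_nonneg_right ?_ (Real.sqrt_nonneg _)
  have h2 := Real.sum_mul_le_sqrt_mul_sqrt Finset.univ (fun i => |h i|)
    (fun i => √(∫ x in C, g i x ^ 2))
  refine h2.trans (le_of_eq ?_)
  rw [EuclideanSpace.norm_eq]
  congr 2
  refine Finset.sum_congr rfl fun i _ => ?_
  exact Real.sq_sqrt (integral_nonneg fun x => sq_nonneg _)

/-- The translation estimate for functions with a weak gradient in a convex set. -/
theorem HasWeakGradient.integral_translate_sub_sq_le (hCo : IsOpen C) (hCc : Convex ℝ C)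
    (hC : volume C ≠ ⊤) (hy : MemLp y 2 (volume.restrict C))
    (hg : ∀ i, MemLp (g i) 2 (volume.restrict C)) (hyg : HasWeakGradient C y g) (h : Eucl d) :
    IntegrableOn (fun x => (y (x + h) - y x) ^ 2) (C ∩ (fun x => x + h) ⁻¹' C) ∧
    ∫ x in C ∩ (fun x => x + h) ⁻¹' C, (y (x + h) - y x) ^ 2 ≤
      ‖h‖ ^ 2 * ∑ i, ∫ x in C, g i x ^ 2 := by
  set D := C ∩ (fun x => x + h) ⁻¹' C with hD
  have hDo : IsOpen D := hCo.inter (hCo.preimage (by fun_prop))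
  have hyD : MemLp y 2 (volume.restrict D) :=
    hy.mono_measure (Measure.restrict_mono inter_subset_left le_rfl)
  have hyC' : MemLp (fun x => y (x + h)) 2 (volume.restrict ((fun x => x + h) ⁻¹' C)) := by
    have hmp := (measurePreserving_add_right (volume : Measure (Eucl d)) h).restrict_preimage
      hCo.measurableSet
    exact hy.comp_measurePreserving hmp
  have hyD' : MemLp (fun x => y (x + h)) 2 (volume.restrict D) :=
    hyC'.mono_measure (Measure.restrict_mono inter_subset_right le_rfl)
  have hF := hyD'.sub hyD
  refine ⟨hF.integrable_sq, ?_⟩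
  have hG : 0 ≤ ∑ i, ∫ x in C, g i x ^ 2 :=
    Finset.sum_nonneg fun i _ => integral_nonneg fun x => sq_nonneg _
  have := integral_sq_le_of_test hDo hF (K := ‖h‖ * √(∑ i, ∫ x in C, g i x ^ 2)) (by positivity)
    fun φ hφ => ?_
  · rw [mul_pow, Real.sq_sqrt hG] at this
    exact this
  -- The point where convexity enters: `x` and `x + h` lie in `C`, hence so does the segment between
  -- them, and every intermediate translate of `φ` is a test function in `C`.
  · have hmem : ∀ t ∈ Icc (0 : ℝ) 1, ∀ x ∈ D, x + t • h ∈ C := by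
      intro t ht x hx
      have := hCc hx.1 hx.2 (sub_nonneg.2 ht.2) ht.1 (by ring)
      convert this using 1
      module
    have hder := fun t ht =>
      hyg.hasDerivAt_integral_translate hC hy hφ h (hmem t ht)
    have hDsq : ∀ v, ∫ x in C, φ (x - v) ^ 2 ≤ ∫ x in D, φ x ^ 2 := by
      intro v
      have hi := (hφ.memLp volume).integrable_sq
      calc ∫ x in C, φ (x - v) ^ 2 ≤ ∫ x, φ (x - v) ^ 2 :=
            setIntegral_le_integral (hi.comp_sub_right v)
              (Filter.Eventually.of_forall fun x => sq_nonneg _)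
        _ = ∫ x, φ x ^ 2 := integral_sub_right_eq_self (fun x => φ x ^ 2) v
        _ = ∫ x in D, φ x ^ 2 := (setIntegral_eq_integral_of_forall_compl_eq_zero
            fun x hx => by simp [hφ.eq_zero_of_notMem hx]).symm
    -- Mean value inequality for `t ↦ ∫ y φ(· - t h)` on `[0, 1]`. After a change of variables the
    -- difference of its endpoint values is the pairing of `y(· + h) - y` with `φ` on `D`.
    have hmv := norm_image_sub_le_of_norm_deriv_le_segment' (a := (0 : ℝ)) (b := 1)
      (C := ‖h‖ * √(∑ i, ∫ x in C, g i x ^ 2) * √(∫ x in D, φ x ^ 2))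
      (fun t ht => (hder t ht).hasDerivWithinAt)
      (fun t ht => (abs_sum_mul_integral_le hg
        ((hφ.comp_sub _ (hmem t ⟨ht.1, ht.2.le⟩)).memLp _) h).trans
        (mul_le_mul_of_nonneg_left (Real.sqrt_le_sqrt (hDsq _)) (by positivity)))
      1 (right_mem_Icc.2 zero_le_one)
    simp only [zero_smul, sub_zero, one_smul, mul_one, Real.norm_eq_abs] at hmv
    convert hmv using 2
    have e1 : ∫ x in C, y x * φ (x - h) = ∫ x in D, y (x + h) * φ x := by
      have e := (measurePreserving_add_right (volume : Measure (Eucl d)) h).setIntegral_preimage_emb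
        (measurableEmbedding_addRight h) (fun x => y x * φ (x - h)) C
      rw [← e]
      simp only [add_sub_cancel_right]
      refine setIntegral_eq_of_subset_of_forall_sdiff_eq_zero
        (hCo.preimage (by fun_prop)).measurableSet inter_subset_right ?_
      intro x hx
      simp [hφ.eq_zero_of_notMem hx.2]
    have e2 : ∫ x in C, y x * φ x = ∫ x in D, y x * φ x := by
      refine setIntegral_eq_of_subset_of_forall_sdiff_eq_zero hCo.measurableSet inter_subset_left ?_
      intro x hx
      simp [hφ.eq_zero_of_notMem hx.2]
    have e3 := integral_sub (hyD'.integrable_mul (hφ.memLp (volume.restrict D)))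
      (hyD.integrable_mul (hφ.memLp (volume.restrict D)))
    simp only [Pi.mul_apply] at e3
    rw [e1, e2, ← e3]
    congr 1; ext x; simp [sub_mul]

/-- The double integral of squared differences over a convex set is controlled by the gradient. -/
theorem HasWeakGradient.lintegral_lintegral_sub_sq_le (hCo : IsOpen C) (hCc : Convex ℝ C)
    (hC : volume C ≠ ⊤) (hym : Measurable y) (hy : MemLp y 2 (volume.restrict C))
    (hg : ∀ i, MemLp (g i) 2 (volume.restrict C)) (hyg : HasWeakGradient C y g) {r : ℝ}
    (hr : ∀ x ∈ C, ∀ z ∈ C, ‖z - x‖ ≤ r) :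
    ∫⁻ x in C, ∫⁻ z in C, ENNReal.ofReal ((y z - y x) ^ 2) ≤
      ENNReal.ofReal (r ^ 2 * ∑ i, ∫ x in C, g i x ^ 2) *
        volume (Metric.closedBall (0 : Eucl d) r) := by
  set G := ∑ i, ∫ x in C, g i x ^ 2
  have hG : 0 ≤ G := Finset.sum_nonneg fun i _ => integral_nonneg fun x => sq_nonneg _
  have hCm := hCo.measurableSet
  -- Substituting `z = x + h` and exchanging the integrals puts the translation outside. The inner
  -- integral is then at most `r² G`, and it vanishes for `‖h‖ > r`, since no two points of `C`
  -- differ by such an `h`.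
  set Fn : Eucl d → Eucl d → ENNReal := fun x h =>
    C.indicator 1 x * (C.indicator 1 (x + h) * ENNReal.ofReal ((y (x + h) - y x) ^ 2)) with hFn
  have hFm : Measurable (Function.uncurry Fn) := by
    have h1 : Measurable (C.indicator (1 : Eucl d → ENNReal)) := measurable_one.indicator hCm
    simp only [hFn, Function.uncurry_def]
    fun_prop
  have e1 : ∫⁻ x in C, ∫⁻ z in C, ENNReal.ofReal ((y z - y x) ^ 2) = ∫⁻ x, ∫⁻ h, Fn x h := by
    rw [← lintegral_indicator hCm]
    refine lintegral_congr fun x => ?_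
    by_cases hx : x ∈ C
    · simp only [hFn, indicator_of_mem hx, Pi.one_apply, one_mul]
      rw [lintegral_add_left_eq_self (fun z => C.indicator 1 z * ENNReal.ofReal ((y z - y x) ^ 2)) x,
        ← lintegral_indicator hCm]
      refine lintegral_congr fun z => ?_
      by_cases hz : z ∈ C <;> simp [hz]
    · simp [hFn, hx]
  rw [e1, lintegral_lintegral_swap hFm.aemeasurable]
  calc ∫⁻ h, ∫⁻ x, Fn x h
      ≤ ∫⁻ h, (Metric.closedBall (0 : Eucl d) r).indicator
          (fun _ => ENNReal.ofReal (r ^ 2 * G)) h := by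
        refine lintegral_mono fun h => ?_
        have e2 : ∫⁻ x, Fn x h = ∫⁻ x in C ∩ (fun x => x + h) ⁻¹' C,
            ENNReal.ofReal ((y (x + h) - y x) ^ 2) := by
          rw [← lintegral_indicator (hCm.inter (hCm.preimage (by fun_prop)))]
          refine lintegral_congr fun x => ?_
          by_cases hx : x ∈ C <;> by_cases hz : x + h ∈ C <;> simp [hFn, hx, hz, indicator]
        by_cases hh : h ∈ Metric.closedBall (0 : Eucl d) r
        · rw [indicator_of_mem hh, e2]
          obtain ⟨hi, hle⟩ := hyg.integral_translate_sub_sq_le hCo hCc hC hy hg h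
          rw [← ofReal_integral_eq_lintegral_ofReal hi
            (Filter.Eventually.of_forall fun x => sq_nonneg _)]
          refine ENNReal.ofReal_le_ofReal (hle.trans ?_)
          refine mul_le_mul_of_nonneg_right ?_ hG
          exact pow_le_pow_left₀ (norm_nonneg _) (by simpa using hh) 2
        · have : C ∩ (fun x => x + h) ⁻¹' C = ∅ := by
            rw [eq_empty_iff_forall_notMem]
            rintro x ⟨hx, hz⟩
            refine hh ?_
            have := hr x hx _ hz
            simpa using this
          simp [e2, this]
    _ = _ := by
        rw [lintegral_indicator Metric.isClosed_closedBall.measurableSet]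
        simp

end Translation

/-! ### Poincaré inequality on a single convex cell. -/

section CellPoincare

variable {d : ℕ} {C : Set (Eucl d)} {y : Eucl d → ℝ} {g : Fin d → Eucl d → ℝ}

theorem measure_le_measure_closedBall {r : ℝ} (hr : ∀ x ∈ C, ∀ z ∈ C, ‖z - x‖ ≤ r) :
    volume C ≤ volume (Metric.closedBall (0 : Eucl d) r) := by
  rcases C.eq_empty_or_nonempty with rfl | ⟨x, hx⟩
  · simp
  · have : C ⊆ Metric.closedBall x r := fun z hz => by
      rw [mem_closedBall_iff_norm]; exact hr x hx z hz
    exact (measure_mono this).trans (Measure.addHaar_closedBall_center volume x r).le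

/-- A Poincaré inequality in a convex cell `C` with an averaging set `ω ⊆ C`. -/
theorem HasWeakGradient.integral_sq_le (hCo : IsOpen C) (hCc : Convex ℝ C)
    (hym : Measurable y) (hy : MemLp y 2 (volume.restrict C))
    (hg : ∀ i, MemLp (g i) 2 (volume.restrict C)) (hyg : HasWeakGradient C y g) {r : ℝ}
    (hr : ∀ x ∈ C, ∀ z ∈ C, ‖z - x‖ ≤ r) {ω : Set (Eucl d)} (hω : ω ⊆ C)
    (hωpos : 0 < volume.real ω) :
    volume.real ω / 2 * ∫ x in C, y x ^ 2 ≤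
      (r ^ 2 * (∑ i, ∫ x in C, g i x ^ 2) + 2 * ((∫ x in ω, y x) ^ 2 / volume.real ω)) *
        volume.real (Metric.closedBall (0 : Eucl d) r) := by
  have hCB := measure_le_measure_closedBall hr
  have hC : volume C ≠ ⊤ := (hCB.trans_lt measure_closedBall_lt_top).ne
  have hG : 0 ≤ ∑ i, ∫ x in C, g i x ^ 2 :=
    Finset.sum_nonneg fun i _ => integral_nonneg fun x => sq_nonneg _
  set G := ∑ i, ∫ x in C, g i x ^ 2
  set m := ∫ x in ω, y x with hm
  set μ := volume.real ω with hμ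
  have hωt : volume ω ≠ ⊤ := ((measure_mono hω).trans_lt hC.lt_top).ne
  have hfin : IsFiniteMeasure (volume.restrict ω) := ⟨by simpa using hωt.lt_top⟩
  have hyω : MemLp y 2 (volume.restrict ω) := hy.mono_measure (Measure.restrict_mono hω le_rfl)
  -- Expand the integral of `(y z - y x)²` over `z ∈ ω`, drop `∫ y²` and absorb the cross term by
  -- Young's inequality `2 y m ≤ μ/2 y² + 2 m²/μ`. This leaves half of `μ y²`; the integration
  -- domain is then enlarged from `ω` to `C`.
  have hpt : ∀ x, ENNReal.ofReal (μ / 2 * y x ^ 2) ≤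
      (∫⁻ z in C, ENNReal.ofReal ((y z - y x) ^ 2)) + ENNReal.ofReal (2 * (m ^ 2 / μ)) := by
    intro x
    have hi1 : Integrable (fun z => y z ^ 2) (volume.restrict ω) := hyω.integrable_sq
    have hi2 : Integrable (fun z => 2 * y x * y z) (volume.restrict ω) :=
      (hyω.integrable (by norm_num)).const_mul _
    have hi3 : Integrable (fun z => (y z - y x) ^ 2) (volume.restrict ω) :=
      (hyω.sub (memLp_const (y x))).integrable_sq
    have e : ∫ z in ω, (y z - y x) ^ 2 =
        (∫ z in ω, y z ^ 2) - 2 * y x * m + μ * y x ^ 2 := by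
      have : ∀ z, (y z - y x) ^ 2 = y z ^ 2 - 2 * y x * y z + y x ^ 2 := fun z => by ring
      simp_rw [this]
      have e1 := integral_add (hi1.sub hi2) (integrable_const (y x ^ 2))
      simp only [Pi.sub_apply] at e1
      rw [e1, integral_sub hi1 hi2, integral_const_mul]
      simp [hμ, ← hm]
    have hle : μ / 2 * y x ^ 2 ≤ (∫ z in ω, (y z - y x) ^ 2) + 2 * (m ^ 2 / μ) := by
      have h0 : 0 ≤ ∫ z in ω, y z ^ 2 := integral_nonneg fun z => sq_nonneg _
      have h1 : 0 ≤ μ / 2 * (y x - 2 * m / μ) ^ 2 := by positivity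
      have h2 : μ / 2 * (y x - 2 * m / μ) ^ 2 =
          μ / 2 * y x ^ 2 - 2 * y x * m + 2 * (m ^ 2 / μ) := by
        field_simp; ring
      rw [e]; linarith
    calc ENNReal.ofReal (μ / 2 * y x ^ 2)
        ≤ ENNReal.ofReal ((∫ z in ω, (y z - y x) ^ 2) + 2 * (m ^ 2 / μ)) :=
          ENNReal.ofReal_le_ofReal hle
      _ = (∫⁻ z in ω, ENNReal.ofReal ((y z - y x) ^ 2)) + ENNReal.ofReal (2 * (m ^ 2 / μ)) := by
          rw [ENNReal.ofReal_add (integral_nonneg fun z => sq_nonneg _) (by positivity),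
            ofReal_integral_eq_lintegral_ofReal hi3
              (Filter.Eventually.of_forall fun x => sq_nonneg _)]
      _ ≤ _ := add_le_add (lintegral_mono_set hω) le_rfl
  have hB : volume (Metric.closedBall (0 : Eucl d) r) =
      ENNReal.ofReal (volume.real (Metric.closedBall (0 : Eucl d) r)) :=
    (ENNReal.ofReal_toReal measure_closedBall_lt_top.ne).symm
  have hmain : ENNReal.ofReal (μ / 2 * ∫ x in C, y x ^ 2) ≤
      ENNReal.ofReal ((r ^ 2 * G + 2 * (m ^ 2 / μ)) *
        volume.real (Metric.closedBall (0 : Eucl d) r)) := by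
    calc ENNReal.ofReal (μ / 2 * ∫ x in C, y x ^ 2)
        = ∫⁻ x in C, ENNReal.ofReal (μ / 2 * y x ^ 2) := by
          rw [← integral_const_mul, ofReal_integral_eq_lintegral_ofReal
            (hy.integrable_sq.const_mul _)
            (Filter.Eventually.of_forall fun x => by simp only [Pi.zero_apply]; positivity)]
      _ ≤ ∫⁻ x in C, ((∫⁻ z in C, ENNReal.ofReal ((y z - y x) ^ 2)) +
            ENNReal.ofReal (2 * (m ^ 2 / μ))) := lintegral_mono fun x => hpt x
      _ = (∫⁻ x in C, ∫⁻ z in C, ENNReal.ofReal ((y z - y x) ^ 2)) +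
            ENNReal.ofReal (2 * (m ^ 2 / μ)) * volume C := by
          rw [lintegral_add_right _ measurable_const]; simp
      _ ≤ ENNReal.ofReal (r ^ 2 * G) * volume (Metric.closedBall (0 : Eucl d) r) +
            ENNReal.ofReal (2 * (m ^ 2 / μ)) * volume (Metric.closedBall (0 : Eucl d) r) :=
          add_le_add (hyg.lintegral_lintegral_sub_sq_le hCo hCc hC hym hy hg hr)
            (mul_le_mul_right hCB _)
      _ = _ := by
          rw [← add_mul, hB, ← ENNReal.ofReal_add (by positivity) (by positivity),
            ← ENNReal.ofReal_mul (by positivity)]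
  exact (ENNReal.ofReal_le_ofReal_iff (by positivity)).1 hmain

end CellPoincare

/-! ### Sobolev spaces and existence of regularized indicators. -/

section Sobolev

variable {d : ℕ} {Ω C : Set (Eucl d)}

theorem HasWeakGradient.mono {y : Eucl d → ℝ} {g : Fin d → Eucl d → ℝ}
    (hyg : HasWeakGradient Ω y g) (hΩ : MeasurableSet Ω) (hC : C ⊆ Ω) :
    HasWeakGradient C y g := by
  intro φ hφ i
  have h1 : ∫ x in Ω, y x * partialDeriv i φ x = ∫ x in C, y x * partialDeriv i φ x := by
    refine setIntegral_eq_of_subset_of_forall_sdiff_eq_zero hΩ hC fun x hx => ?_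
    have : fderiv ℝ φ x = 0 := by
      refine image_eq_zero_of_notMem_tsupport fun hx' => hx.2 (hφ.2.2 ?_)
      exact tsupport_fderiv_subset ℝ hx'
    simp [partialDeriv, this]
  have h2 : ∫ x in Ω, g i x * φ x = ∫ x in C, g i x * φ x :=
    setIntegral_eq_of_subset_of_forall_sdiff_eq_zero hΩ hC fun x hx => by
      simp [hφ.eq_zero_of_notMem hx.2]
  rw [← h1, ← h2]
  exact hyg φ (hφ.mono hC) i

theorem L2_inner_toLp {α : Type*} [MeasurableSpace α] {μ : Measure α} {φ : α → ℝ}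
    (hφ : MemLp φ 2 μ) (f : Lp ℝ 2 μ) : inner ℝ f (hφ.toLp φ) = ∫ x, f x * φ x ∂μ := by
  rw [L2.inner_def]
  refine integral_congr_ae ?_
  filter_upwards [hφ.coeFn_toLp] with x hx
  simp [hx, mul_comm]

/-- Each defining identity equates two continuous functionals, inner products with fixed `L²`
classes. Closedness makes the closure of the test functions consist of pairs with a genuine weak
gradient. -/
theorem isClosed_sobolevSpace : IsClosed (sobolevSpace Ω : Set (Jet Ω)) := by
  have : (sobolevSpace Ω : Set (Jet Ω)) = ⋂ (φ : Eucl d → ℝ) (hφ : IsTestFunction Ω φ) (i : Fin d),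
      {p : Jet Ω | inner ℝ p.fst ((hφ.memLp_partialDeriv i (volume.restrict Ω)).toLp _) =
        -inner ℝ (p.snd i) ((hφ.memLp (volume.restrict Ω)).toLp φ)} := by
    ext p
    simp only [mem_iInter, mem_ofPred_eq, L2_inner_toLp]
    rfl
  rw [this]
  refine isClosed_iInter fun φ => isClosed_iInter fun hφ => isClosed_iInter fun i => ?_
  have h1 : Continuous fun p : Jet Ω => p.fst :=
    (WithLp.fstL 2 ℝ (LTwo Ω) (PiLp 2 (fun _ : Fin d => LTwo Ω))).continuous
  have h2 : Continuous fun p : Jet Ω => p.snd i :=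
    (PiLp.continuous_apply 2 (fun _ : Fin d => LTwo Ω) i).comp
      (WithLp.sndL 2 ℝ (LTwo Ω) (PiLp 2 (fun _ : Fin d => LTwo Ω))).continuous
  exact isClosed_eq (h1.inner continuous_const) (h2.inner continuous_const).neg

theorem IsTestFunction.hasWeakGradient {φ : Eucl d → ℝ} (hφ : IsTestFunction Ω φ) :
    HasWeakGradient Ω φ (fun i => partialDeriv i φ) := by
  intro ψ hψ i
  have e1 : ∫ x in Ω, φ x * partialDeriv i ψ x = ∫ x, φ x * partialDeriv i ψ x :=
    setIntegral_eq_integral_of_forall_compl_eq_zero fun x hx => by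
      simp [hφ.eq_zero_of_notMem hx]
  have e2 : ∫ x in Ω, partialDeriv i φ x * ψ x = ∫ x, partialDeriv i φ x * ψ x :=
    setIntegral_eq_integral_of_forall_compl_eq_zero fun x hx => by
      simp [hψ.eq_zero_of_notMem hx]
  rw [e1, e2]
  exact integral_mul_fderiv_eq_neg_fderiv_mul_of_integrable
    ((hφ.memLp_partialDeriv i volume).integrable_mul (hψ.memLp volume))
    ((hφ.memLp volume).integrable_mul (hψ.memLp_partialDeriv i volume))
    ((hφ.memLp volume).integrable_mul (hψ.memLp volume))
    (fun x _ => hφ.1.differentiable (by simp) x) (fun x _ => hψ.1.differentiable (by simp) x)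

theorem sobolevSpaceZero_le_sobolevSpace : sobolevSpaceZero Ω ≤ sobolevSpace Ω := by
  refine Submodule.topologicalClosure_minimal _ (Submodule.span_le.2 ?_) isClosed_sobolevSpace
  rintro p ⟨φ, hφ, h1, h2⟩ ψ hψ i
  have := hφ.hasWeakGradient ψ hψ i
  exact (integral_congr_ae (h1.mono fun x hx => by simp only [hx])).trans (this.trans
    (congrArg Neg.neg (integral_congr_ae ((h2 i).mono fun x hx => by simp only [hx]))))

variable {bc : BoundaryCondition}

/-- This lets both boundary conditions be treated at once: the estimates use only the weak gradient,
never the trace. -/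
theorem energySpace_le_sobolevSpace : energySpace Ω bc ≤ sobolevSpace Ω := by
  cases bc
  · exact sobolevSpaceZero_le_sobolevSpace
  · exact le_rfl

theorem hasWeakGradient_weakGrad (w : energySpace Ω bc) :
    HasWeakGradient Ω (inclH Ω bc w) (fun i => weakGrad Ω bc w i) :=
  energySpace_le_sobolevSpace w.2

theorem sq_norm_weakGrad (w : energySpace Ω bc) :
    ‖weakGrad Ω bc w‖ ^ 2 = ∑ i, ∫ x in Ω, weakGrad Ω bc w i x ^ 2 := by
  rw [PiLp.norm_sq_eq_of_L2]
  refine Finset.sum_congr rfl fun i _ => ?_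
  rw [← real_inner_self_eq_norm_sq, L2.inner_def]
  simp [sq]

theorem IsTestFunction.exists_inclH_eq {φ : Eucl d → ℝ} (hφ : IsTestFunction Ω φ) :
    ∃ w : energySpace Ω bc, inclH Ω bc w =ᵐ[volume.restrict Ω] φ := by
  set p : Jet Ω := WithLp.toLp 2 ((hφ.memLp (volume.restrict Ω)).toLp φ,
    WithLp.toLp 2 fun i => (hφ.memLp_partialDeriv i (volume.restrict Ω)).toLp _)
  have hp : p ∈ sobolevSpaceZero Ω :=
    Submodule.le_topologicalClosure _ (Submodule.subset_span
      ⟨φ, hφ, (hφ.memLp _).coeFn_toLp, fun i => (hφ.memLp_partialDeriv i _).coeFn_toLp⟩)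
  have hp' : p ∈ energySpace Ω bc := by
    cases bc
    · exact hp
    · exact sobolevSpaceZero_le_sobolevSpace hp
  exact ⟨⟨p, hp'⟩, (hφ.memLp (volume.restrict Ω)).coeFn_toLp⟩

/-- A smooth bump supported in `ω` with value `1` at one point works. It is nonzero in `L²`, because
a continuous function vanishing a.e. on an open set vanishes there. -/
theorem exists_isRegularizedIndicator {ω : Set (Eucl d)} (hω : IsOpen ω) (hne : ω.Nonempty)
    (hωΩ : ω ⊆ Ω) : ∃ φ : energySpace Ω bc, IsRegularizedIndicator Ω bc ω φ := by
  obtain ⟨x, hx⟩ := hne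
  obtain ⟨f, hfs, hfc, hfd, hfr, hfx⟩ :=
    exists_contDiff_tsupport_subset (n := (⊤ : ℕ∞)) (hω.mem_nhds hx)
  have hf : IsTestFunction Ω f := ⟨hfd, hfc, hfs.trans hωΩ⟩
  obtain ⟨w, hw⟩ := hf.exists_inclH_eq (bc := bc)
  refine ⟨w, ?_, ?_⟩
  · filter_upwards [hw] with z hz
    rw [hz]
    exact ⟨hfr (mem_range_self z), fun hzω =>
      image_eq_zero_of_notMem_tsupport fun h => hzω (hfs h)⟩
  · intro h0
    rw [h0] at hw
    have h1 : f =ᵐ[volume.restrict Ω] 0 := hw.symm.trans (Lp.coeFn_zero _ _ _)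
    have h2 : f =ᵐ[volume.restrict ω] 0 := h1.filter_mono (ae_mono (Measure.restrict_mono hωΩ le_rfl))
    have h4 := Measure.eqOn_open_of_ae_eq h2 hω hfd.continuous.continuousOn continuousOn_const
    have := h4 hx
    simp [hfx] at this

end Sobolev

/-! ### Complements of finite-dimensional subspaces and oblique projections. -/

section Hilbert

variable {H : Type*} [NormedAddCommGroup H] [InnerProductSpace ℝ H]

/-- The orthogonal projections `F → U` and `U → F` are both injective, so the dimensions agree and
`U → F` is onto. Hence every `x` has the same projection on `F` as some `u ∈ U`, and `x - u ∈ Fᗮ`.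
-/
theorem isCompl_orthogonal_of_isCompl {F U : Submodule ℝ H} [FiniteDimensional ℝ F]
    [FiniteDimensional ℝ U] (h : IsCompl F Uᗮ) : IsCompl U Fᗮ := by
  have hdis : U ⊓ Fᗮ = ⊥ := by
    rw [Submodule.eq_bot_iff]
    rintro x ⟨hxU, hxF⟩
    obtain ⟨f, hf, g, hg, rfl⟩ := Submodule.mem_sup.1 (h.sup_eq_top ▸ Submodule.mem_top (x := x))
    rw [← inner_self_eq_zero (𝕜 := ℝ)]
    conv_lhs => rw [inner_add_left]
    rw [hxF f hf, real_inner_comm, hg _ hxU, zero_add]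
  let a : F →ₗ[ℝ] U := (U.orthogonalProjectionOnto : H →ₗ[ℝ] U).domRestrict F
  let b : U →ₗ[ℝ] F := (F.orthogonalProjectionOnto : H →ₗ[ℝ] F).domRestrict U
  have ha : Function.Injective a := by
    rw [← LinearMap.ker_eq_bot, Submodule.eq_bot_iff]
    intro x hx
    have h1 : (x : H) ∈ Uᗮ := Submodule.orthogonalProjectionOnto_eq_zero_iff.1 hx
    have h2 : (x : H) ∈ F ⊓ Uᗮ := ⟨x.2, h1⟩
    rw [h.inf_eq_bot] at h2
    exact Subtype.ext h2
  have hb : Function.Injective b := by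
    rw [← LinearMap.ker_eq_bot, Submodule.eq_bot_iff]
    intro x hx
    have h1 : (x : H) ∈ Fᗮ := Submodule.orthogonalProjectionOnto_eq_zero_iff.1 hx
    have h2 : (x : H) ∈ U ⊓ Fᗮ := ⟨x.2, h1⟩
    rw [hdis] at h2
    exact Subtype.ext h2
  have hdim : Module.finrank ℝ U = Module.finrank ℝ F :=
    le_antisymm (LinearMap.finrank_le_finrank_of_injective hb)
      (LinearMap.finrank_le_finrank_of_injective ha)
  have hbs : Function.Surjective b := (LinearMap.injective_iff_surjective_of_finrank_eq_finrank hdim).1 hb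
  refine ⟨disjoint_iff.2 hdis, codisjoint_iff.2 (Submodule.eq_top_iff'.2 fun x => ?_)⟩
  obtain ⟨u, hu⟩ := hbs (F.orthogonalProjectionOnto x)
  refine Submodule.mem_sup.2 ⟨u, u.2, x - u, ?_, by abel⟩
  rw [← Submodule.orthogonalProjectionOnto_eq_zero_iff, map_sub, sub_eq_zero]
  exact hu.symm

end Hilbert

section Oblique

variable {d : ℕ} {Ω : Set (Eucl d)} {F G U : Submodule ℝ (LTwo Ω)}

theorem obliqueProj_mem (F G : Submodule ℝ (LTwo Ω)) (x : LTwo Ω) : obliqueProj Ω F G x ∈ F := by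
  unfold obliqueProj
  split_ifs with h
  · exact Submodule.projection_apply_mem h x
  · simp

theorem sub_obliqueProj_mem (h : IsCompl F G) (x : LTwo Ω) : x - obliqueProj Ω F G x ∈ G := by
  have := Submodule.projection_add_projection_eq_self h x
  rw [obliqueProj, dif_pos h, ← eq_sub_of_add_eq' this]
  exact Submodule.projection_apply_mem h.symm x

theorem obliqueProj_eq_of_sub_mem (h : IsCompl F G) {x y : LTwo Ω} (hxy : x - y ∈ G) :
    obliqueProj Ω F G x = obliqueProj Ω F G y := by
  have h1 : obliqueProj Ω F G x - obliqueProj Ω F G y ∈ F ⊓ G := by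
    refine ⟨F.sub_mem (obliqueProj_mem F G x) (obliqueProj_mem F G y), ?_⟩
    have := G.add_mem (G.sub_mem hxy (sub_obliqueProj_mem h x)) (sub_obliqueProj_mem h y)
    have e : obliqueProj Ω F G x - obliqueProj Ω F G y =
        x - y - (x - obliqueProj Ω F G x) + (y - obliqueProj Ω F G y) := by abel
    rw [e]; exact this
  rw [h.inf_eq_bot] at h1
  exact sub_eq_zero.1 h1

theorem obliqueProj_of_mem (h : IsCompl F G) {x : LTwo Ω} (hx : x ∈ F) :
    obliqueProj Ω F G x = x := by
  have h1 : x - obliqueProj Ω F G x ∈ F ⊓ G :=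
    ⟨F.sub_mem hx (obliqueProj_mem F G x), sub_obliqueProj_mem h x⟩
  rw [h.inf_eq_bot] at h1
  exact (sub_eq_zero.1 h1).symm

/-- The two oblique projections are adjoint to each other, so their product is of the form `q* q`.
This is what makes the oblique operators dissipative. -/
theorem inner_obliqueProj_obliqueProj (hF : IsCompl F Uᗮ) (hU : IsCompl U Fᗮ) (x : LTwo Ω) :
    inner ℝ (obliqueProj Ω U Fᗮ (obliqueProj Ω F Uᗮ x)) x = ‖obliqueProj Ω F Uᗮ x‖ ^ 2 := by
  have h1 := sub_obliqueProj_mem hF x _ (obliqueProj_mem U Fᗮ (obliqueProj Ω F Uᗮ x))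
  have h2 := sub_obliqueProj_mem hU (obliqueProj Ω F Uᗮ x) _ (obliqueProj_mem F Uᗮ x)
  rw [inner_sub_right, sub_eq_zero] at h1 h2
  rw [h1, real_inner_comm, ← h2, real_inner_self_eq_norm_sq]

/-- The vector `r` is the orthogonal projection onto `U` of `x`, and also of its oblique projection,
which differs from `x` by an element of `Uᗮ`. Orthogonal projections do not increase the norm. -/
theorem norm_le_norm_obliqueProj (hF : IsCompl F Uᗮ) {x r : LTwo Ω} (hr : r ∈ U)
    (hxr : x - r ∈ Uᗮ) : ‖r‖ ≤ ‖obliqueProj Ω F Uᗮ x‖ := by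
  have h1 := sub_obliqueProj_mem hF x _ hr
  have h2 := hxr _ hr
  rw [inner_sub_right, sub_eq_zero] at h1 h2
  have h3 : ‖r‖ * ‖r‖ ≤ ‖r‖ * ‖obliqueProj Ω F Uᗮ x‖ := by
    rw [← real_inner_self_eq_norm_mul_norm, ← h2, h1]
    exact real_inner_le_norm _ _
  rcases (norm_nonneg r).eq_or_lt with h0 | h0
  · rw [← h0]; exact norm_nonneg _
  · exact le_of_mul_le_mul_left h3 h0

end Oblique

/-! ### Disjoint devices, their averages and the four operators. -/

section Devices

variable {d : ℕ} {Ω : Set (Eucl d)}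

theorem indicatorL2_eq (hΩ : volume Ω ≠ ⊤) {ω : Set (Eucl d)} (hω : IsOpen ω) :
    ∃ h : volume.restrict Ω ω ≠ ⊤,
      indicatorL2 Ω ω = indicatorConstLp 2 hω.measurableSet h (1 : ℝ) := by
  have hfin : IsFiniteMeasure (volume.restrict Ω) := ⟨by simpa using hΩ.lt_top⟩
  have h : volume.restrict Ω ω ≠ ⊤ := measure_ne_top _ _
  refine ⟨h, ?_⟩
  rw [indicatorL2, dif_pos (memLp_indicator_const 2 hω.measurableSet 1 (Or.inr h))]
  rfl

theorem inner_indicatorL2 (hΩ : volume Ω ≠ ⊤) {ω : Set (Eucl d)} (hω : IsOpen ω) (hωΩ : ω ⊆ Ω)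
    (f : LTwo Ω) : inner ℝ (indicatorL2 Ω ω) f = ∫ x in ω, f x := by
  obtain ⟨h, e⟩ := indicatorL2_eq hΩ hω
  rw [e, L2.inner_indicatorConstLp_one, Measure.restrict_restrict_of_subset hωΩ]

theorem inner_indicatorL2_indicatorL2 (hΩ : volume Ω ≠ ⊤) {ω ω' : Set (Eucl d)} (hω : IsOpen ω)
    (hω' : IsOpen ω') (hωΩ : ω ⊆ Ω) :
    inner ℝ (indicatorL2 Ω ω) (indicatorL2 Ω ω') = volume.real (ω ∩ ω') := by
  obtain ⟨h, e⟩ := indicatorL2_eq hΩ hω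
  obtain ⟨h', e'⟩ := indicatorL2_eq hΩ hω'
  rw [e, e', L2.inner_indicatorConstLp_one_indicatorConstLp_one]
  rw [measureReal_restrict_apply (hω.inter hω').measurableSet,
    inter_eq_left.2 (inter_subset_left.trans hωΩ)]
  rfl

/-- Pairwise disjoint nonempty open supports of devices in `Ω`. -/
structure IsDeviceFamily {ι : Type} (Ω : Set (Eucl d)) (ω : ι → Set (Eucl d)) : Prop where
  isOpen : ∀ j, IsOpen (ω j)
  nonempty : ∀ j, (ω j).Nonempty
  subset : ∀ j, ω j ⊆ Ω
  disjoint : Pairwise fun i j => Disjoint (ω i) (ω j)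

namespace IsDeviceFamily

variable {ι : Type} {ω : ι → Set (Eucl d)} {bc : BoundaryCondition}

theorem volume_pos (hω : IsDeviceFamily Ω ω) (hΩ : volume Ω ≠ ⊤) (j : ι) :
    0 < volume.real (ω j) :=
  ENNReal.toReal_pos ((hω.isOpen j).measure_pos volume (hω.nonempty j)).ne'
    ((measure_mono (hω.subset j)).trans_lt hΩ.lt_top).ne

theorem inner_self (hω : IsDeviceFamily Ω ω) (hΩ : volume Ω ≠ ⊤) (j : ι) :
    inner ℝ (indicatorL2 Ω (ω j)) (indicatorL2 Ω (ω j)) = volume.real (ω j) := by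
  rw [inner_indicatorL2_indicatorL2 hΩ (hω.isOpen j) (hω.isOpen j) (hω.subset j), inter_self]

theorem inner_of_ne (hω : IsDeviceFamily Ω ω) (hΩ : volume Ω ≠ ⊤) {i j : ι} (h : i ≠ j) :
    inner ℝ (indicatorL2 Ω (ω i)) (indicatorL2 Ω (ω j)) = 0 := by
  rw [inner_indicatorL2_indicatorL2 hΩ (hω.isOpen i) (hω.isOpen j) (hω.subset i),
    (hω.disjoint h).inter_eq]
  simp

theorem _root_.mem_deviceSpan_orthogonal_iff {x : LTwo Ω} :
    x ∈ (deviceSpan Ω ω)ᗮ ↔ ∀ j, inner ℝ (indicatorL2 Ω (ω j)) x = 0 := by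
  refine ⟨fun h j => h _ (Submodule.subset_span (mem_range_self j)), fun h => ?_⟩
  have h1 : deviceSpan Ω ω ≤ (ℝ ∙ x)ᗮ := by
    refine Submodule.span_le.2 ?_
    rintro _ ⟨j, rfl⟩
    rw [SetLike.mem_coe, Submodule.mem_orthogonal_singleton_iff_inner_left]
    exact h j
  intro u hu
  exact Submodule.mem_orthogonal_singleton_iff_inner_left.1 (h1 hu)

theorem inner_regularizedIndicator_pos (hω : IsDeviceFamily Ω ω) (hΩo : IsOpen Ω)
    (hΩ : volume Ω ≠ ⊤) {j : ι} {φ : energySpace Ω bc}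
    (hφ : IsRegularizedIndicator Ω bc (ω j) φ) :
    0 < inner ℝ (indicatorL2 Ω (ω j)) (inclH Ω bc φ) := by
  have hint : IntegrableOn (inclH Ω bc φ) Ω := by
    have hfin : IsFiniteMeasure (volume.restrict Ω) := ⟨by simpa using hΩ.lt_top⟩
    exact (Lp.memLp (inclH Ω bc φ)).integrable (by norm_num)
  have h0 : 0 ≤ᵐ[volume.restrict Ω] inclH Ω bc φ := hφ.1.mono fun x hx => hx.1.1
  have e : ∫ x in ω j, inclH Ω bc φ x = ∫ x in Ω, inclH Ω bc φ x := by
    symm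
    refine setIntegral_eq_of_subset_of_ae_sdiff_eq_zero hΩo.measurableSet.nullMeasurableSet
      (hω.subset j) ?_
    have := (ae_restrict_iff' hΩo.measurableSet).1 hφ.1
    filter_upwards [this] with x hx hx'
    exact (hx hx'.1).2 hx'.2
  rw [inner_indicatorL2 hΩ (hω.isOpen j) (hω.subset j), e]
  refine lt_of_le_of_ne (integral_nonneg_of_ae h0) fun h => hφ.2 ?_
  rw [Lp.eq_zero_iff_ae_eq_zero]
  exact (integral_eq_zero_iff_of_nonneg_ae h0 hint).1 h.symm

theorem inner_regularizedIndicator_of_ne (hω : IsDeviceFamily Ω ω)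
    (hΩ : volume Ω ≠ ⊤) {i j : ι} (hij : i ≠ j) {φ : energySpace Ω bc}
    (hφ : IsRegularizedIndicator Ω bc (ω j) φ) :
    inner ℝ (indicatorL2 Ω (ω i)) (inclH Ω bc φ) = 0 := by
  rw [inner_indicatorL2 hΩ (hω.isOpen i) (hω.subset i)]
  refine integral_eq_zero_of_ae ?_
  have h1 := ae_mono (Measure.restrict_mono (hω.subset i) le_rfl) hφ.1
  filter_upwards [h1, ae_restrict_mem (hω.isOpen i).measurableSet] with x hx hxi
  exact hx.2 fun hxj => (hω.disjoint hij).le_bot ⟨hxi, hxj⟩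

open Classical in
theorem gram_eq_diagonal (hω : IsDeviceFamily Ω ω) (hΩ : volume Ω ≠ ⊤) :
    gram Ω ω = Matrix.diagonal fun j => volume.real (ω j) := by
  ext i j
  by_cases h : i = j
  · subst h
    rw [gram, Matrix.of_apply, hω.inner_self hΩ, Matrix.diagonal_apply_eq]
  · simp [gram, h, hω.inner_of_ne hΩ (Ne.symm h)]

variable [Fintype ι]

open Classical in
theorem isUnit_det_gram (hω : IsDeviceFamily Ω ω) (hΩ : volume Ω ≠ ⊤) :
    IsUnit (gram Ω ω).det := by
  rw [hω.gram_eq_diagonal hΩ, Matrix.det_diagonal, isUnit_iff_ne_zero]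
  exact Finset.prod_ne_zero_iff.2 fun j _ => (hω.volume_pos hΩ j).ne'

theorem gramInv_apply (hω : IsDeviceFamily Ω ω) (hΩ : volume Ω ≠ ⊤) (v : ι → ℝ) (j : ι) :
    gramInv Ω ω v j = v j / volume.real (ω j) := by
  classical
  have e : (gram Ω ω)⁻¹ = Matrix.diagonal fun j => (volume.real (ω j))⁻¹ := by
    refine Matrix.inv_eq_right_inv ?_
    rw [hω.gram_eq_diagonal hΩ, Matrix.diagonal_mul_diagonal, ← Matrix.diagonal_one]
    congr 1
    ext j
    exact mul_inv_cancel₀ (hω.volume_pos hΩ j).ne'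
  have e' : gramInv Ω ω = Matrix.toLin' (gram Ω ω)⁻¹ := by
    unfold gramInv
    convert rfl
  rw [e', e, Matrix.toLin'_apply, Matrix.mulVec_diagonal]
  ring

/-- The operator `U^⋄ [𝒱]⁻¹ U^∨`. -/
noncomputable def _root_.deviceAverage (Ω : Set (Eucl d)) (ω : ι → Set (Eucl d)) :
    LTwo Ω →ₗ[ℝ] LTwo Ω :=
  diamondOp Ω ω ∘ₗ gramInv Ω ω ∘ₗ veeOp Ω ω

theorem deviceAverage_apply (hω : IsDeviceFamily Ω ω) (hΩ : volume Ω ≠ ⊤) (f : LTwo Ω) :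
    deviceAverage Ω ω f =
      ∑ j, ((∫ x in ω j, f x) / volume.real (ω j)) • indicatorL2 Ω (ω j) := by
  simp only [deviceAverage, LinearMap.comp_apply, diamondOp, Fintype.linearCombination_apply]
  refine Finset.sum_congr rfl fun j _ => ?_
  rw [hω.gramInv_apply hΩ, ← inner_indicatorL2 hΩ (hω.isOpen j) (hω.subset j)]
  rfl

theorem deviceAverage_mem (f : LTwo Ω) : deviceAverage Ω ω f ∈ deviceSpan Ω ω := by
  simp only [deviceAverage, LinearMap.comp_apply, diamondOp, Fintype.linearCombination_apply]
  exact Submodule.sum_mem _ fun j _ =>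
    Submodule.smul_mem _ _ (Submodule.subset_span (mem_range_self j))

/-- Together with `deviceAverage_mem` this identifies `deviceAverage` as the orthogonal projection
onto the span of the devices. -/
theorem sub_deviceAverage_mem (hω : IsDeviceFamily Ω ω) (hΩ : volume Ω ≠ ⊤) (f : LTwo Ω) :
    f - deviceAverage Ω ω f ∈ (deviceSpan Ω ω)ᗮ := by
  refine mem_deviceSpan_orthogonal_iff.2 fun i => ?_
  rw [hω.deviceAverage_apply hΩ, inner_sub_right, inner_sum,
    Finset.sum_eq_single i (fun j _ hj => by
      rw [inner_smul_right, hω.inner_of_ne hΩ hj.symm, mul_zero]) (by simp),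
    inner_smul_right, hω.inner_self hΩ, inner_indicatorL2 hΩ (hω.isOpen i) (hω.subset i),
    div_mul_cancel₀ _ (hω.volume_pos hΩ i).ne', sub_self]

theorem inner_deviceAverage (hω : IsDeviceFamily Ω ω) (hΩ : volume Ω ≠ ⊤) (f : LTwo Ω) :
    inner ℝ (deviceAverage Ω ω f) f = ∑ j, (∫ x in ω j, f x) ^ 2 / volume.real (ω j) := by
  rw [hω.deviceAverage_apply hΩ, sum_inner]
  refine Finset.sum_congr rfl fun j _ => ?_
  rw [real_inner_smul_left, inner_indicatorL2 hΩ (hω.isOpen j) (hω.subset j)]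
  ring

theorem inner_deviceAverage_eq_sq (hω : IsDeviceFamily Ω ω) (hΩ : volume Ω ≠ ⊤) (f : LTwo Ω) :
    inner ℝ (deviceAverage Ω ω f) f = ‖deviceAverage Ω ω f‖ ^ 2 := by
  have h := hω.sub_deviceAverage_mem hΩ f _ (deviceAverage_mem f)
  rw [inner_sub_right, sub_eq_zero] at h
  rw [h, real_inner_self_eq_norm_sq]

theorem deviceAverage_of_mem (hω : IsDeviceFamily Ω ω) (hΩ : volume Ω ≠ ⊤) {f : LTwo Ω}
    (hf : f ∈ deviceSpan Ω ω) : deviceAverage Ω ω f = f := by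
  have h : f - deviceAverage Ω ω f ∈ deviceSpan Ω ω ⊓ (deviceSpan Ω ω)ᗮ :=
    ⟨Submodule.sub_mem _ hf (deviceAverage_mem f), hω.sub_deviceAverage_mem hΩ f⟩
  rw [Submodule.inf_orthogonal_eq_bot] at h
  exact (sub_eq_zero.1 h).symm

instance _root_.finiteDimensional_deviceSpan : FiniteDimensional ℝ (deviceSpan Ω ω) :=
  FiniteDimensional.span_of_finite ℝ (finite_range _)

instance _root_.finiteDimensional_auxSpan (Φ : ι → energySpace Ω bc) :
    FiniteDimensional ℝ (auxSpan Ω Φ) :=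
  FiniteDimensional.span_of_finite ℝ (finite_range _)

theorem _root_.isCompl_deviceSpan_auxSpan_orthogonal {Φ : ι → energySpace Ω bc}
    (h : IsCompl (auxSpan Ω Φ) (deviceSpan Ω ω)ᗮ) : IsCompl (deviceSpan Ω ω) (auxSpan Ω Φ)ᗮ :=
  isCompl_orthogonal_of_isCompl h

variable {F : Submodule ℝ (LTwo Ω)} {lam : ℝ}

theorem inner_orthogonalFeedback (hω : IsDeviceFamily Ω ω) (hΩ : volume Ω ≠ ⊤) (f : LTwo Ω) :
    inner ℝ (diamondOp Ω ω (orthogonalFeedback Ω ω lam f)) f =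
      -(lam * inner ℝ (deviceAverage Ω ω f) f) := by
  have e : diamondOp Ω ω (orthogonalFeedback Ω ω lam f) = -lam • deviceAverage Ω ω
      (obliqueProj Ω (deviceSpan Ω ω) (deviceSpan Ω ω)ᗮ f) := by
    simp [orthogonalFeedback, deviceAverage]
  rw [e, hω.deviceAverage_of_mem hΩ (obliqueProj_mem _ _ _),
    obliqueProj_eq_of_sub_mem (Submodule.isCompl_orthogonal _) (hω.sub_deviceAverage_mem hΩ f),
    obliqueProj_of_mem (Submodule.isCompl_orthogonal _) (deviceAverage_mem f),
    real_inner_smul_left]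
  ring

/-- The device average fixes the span of the devices, so only the product of the two oblique
projections survives. -/
theorem inner_obliqueFeedback (hω : IsDeviceFamily Ω ω) (hΩ : volume Ω ≠ ⊤)
    (hF : IsCompl F (deviceSpan Ω ω)ᗮ) (hU : IsCompl (deviceSpan Ω ω) Fᗮ) (f : LTwo Ω) :
    inner ℝ (diamondOp Ω ω (obliqueFeedback Ω ω F lam f)) f =
      -(lam * ‖obliqueProj Ω F (deviceSpan Ω ω)ᗮ f‖ ^ 2) := by
  have e : diamondOp Ω ω (obliqueFeedback Ω ω F lam f) = -lam • deviceAverage Ω ω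
      (obliqueProj Ω (deviceSpan Ω ω) Fᗮ (obliqueProj Ω F (deviceSpan Ω ω)ᗮ f)) := by
    simp [obliqueFeedback, deviceAverage]
  rw [e, hω.deviceAverage_of_mem hΩ (obliqueProj_mem _ _ _), real_inner_smul_left,
    inner_obliqueProj_obliqueProj hF hU]
  ring

theorem _root_.inner_orthogonalInjection (f : LTwo Ω) :
    inner ℝ (orthogonalInjection Ω ω lam (veeOp Ω ω f)) f =
      -(lam * inner ℝ (deviceAverage Ω ω f) f) := by
  have e : orthogonalInjection Ω ω lam (veeOp Ω ω f) = -lam • deviceAverage Ω ω f := rfl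
  rw [e, real_inner_smul_left]
  ring

/-- Here the average acts first. It changes `f` only by an element of the orthogonal complement of
the devices, which the projection onto `F` annihilates, so the quadratic form is that of the
feedback. -/
theorem inner_obliqueInjection (hω : IsDeviceFamily Ω ω) (hΩ : volume Ω ≠ ⊤)
    (hF : IsCompl F (deviceSpan Ω ω)ᗮ) (hU : IsCompl (deviceSpan Ω ω) Fᗮ) (f : LTwo Ω) :
    inner ℝ (obliqueInjection Ω ω F lam (veeOp Ω ω f)) f =
      -(lam * ‖obliqueProj Ω F (deviceSpan Ω ω)ᗮ f‖ ^ 2) := by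
  have e : obliqueInjection Ω ω F lam (veeOp Ω ω f) = -lam •
      obliqueProj Ω (deviceSpan Ω ω) Fᗮ (obliqueProj Ω F (deviceSpan Ω ω)ᗮ
        (deviceAverage Ω ω f)) := rfl
  rw [e, ← obliqueProj_eq_of_sub_mem hF (hω.sub_deviceAverage_mem hΩ f), real_inner_smul_left,
    inner_obliqueProj_obliqueProj hF hU]
  ring

theorem inner_deviceAverage_le (hω : IsDeviceFamily Ω ω) (hΩ : volume Ω ≠ ⊤)
    (hF : IsCompl F (deviceSpan Ω ω)ᗮ) (f : LTwo Ω) :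
    inner ℝ (deviceAverage Ω ω f) f ≤ ‖obliqueProj Ω F (deviceSpan Ω ω)ᗮ f‖ ^ 2 := by
  rw [hω.inner_deviceAverage_eq_sq hΩ]
  exact pow_le_pow_left₀ (norm_nonneg _) (norm_le_norm_obliqueProj hF (deviceAverage_mem f)
    (hω.sub_deviceAverage_mem hΩ f)) 2

/-- Because the supports are disjoint, the matrix of inner products between indicators and auxiliary
functions is diagonal with positive entries. Coefficients can therefore be solved for one at a time.
-/
theorem isCompl_auxSpan_of_isRegularizedIndicator (hω : IsDeviceFamily Ω ω) (hΩo : IsOpen Ω)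
    (hΩ : volume Ω ≠ ⊤) {Φ : ι → energySpace Ω bc}
    (hΦ : ∀ j, IsRegularizedIndicator Ω bc (ω j) (Φ j)) :
    IsCompl (auxSpan Ω Φ) (deviceSpan Ω ω)ᗮ := by
  have hpos := fun j => hω.inner_regularizedIndicator_pos hΩo hΩ (hΦ j)
  have hinner : ∀ (a : ι → ℝ) (i : ι),
      inner ℝ (indicatorL2 Ω (ω i)) (∑ j, a j • inclH Ω bc (Φ j)) =
        a i * inner ℝ (indicatorL2 Ω (ω i)) (inclH Ω bc (Φ i)) := by
    intro a i
    rw [inner_sum, Finset.sum_eq_single i (fun j _ hj => by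
      rw [inner_smul_right, hω.inner_regularizedIndicator_of_ne hΩ hj.symm (hΦ j), mul_zero])
      (by simp), inner_smul_right]
  refine ⟨Submodule.disjoint_def.2 fun x hx hx' => ?_,
    codisjoint_iff.2 (Submodule.eq_top_iff'.2 fun x => ?_)⟩
  · obtain ⟨a, rfl⟩ := (Submodule.mem_span_range_iff_exists_fun ℝ).1 hx
    refine Finset.sum_eq_zero fun i _ => ?_
    have := mem_deviceSpan_orthogonal_iff.1 hx' i
    rw [hinner, mul_eq_zero, or_iff_left (hpos i).ne'] at this
    rw [this, zero_smul]
  · set a : ι → ℝ := fun j => inner ℝ (indicatorL2 Ω (ω j)) x /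
      inner ℝ (indicatorL2 Ω (ω j)) (inclH Ω bc (Φ j)) with ha
    refine Submodule.mem_sup.2 ⟨∑ j, a j • inclH Ω bc (Φ j),
      (Submodule.mem_span_range_iff_exists_fun ℝ).2 ⟨a, rfl⟩,
      x - ∑ j, a j • inclH Ω bc (Φ j), ?_, by abel⟩
    refine mem_deviceSpan_orthogonal_iff.2 fun i => ?_
    rw [inner_sub_right, hinner, ha, div_mul_cancel₀ _ (hpos i).ne', sub_self]

end IsDeviceFamily
end Devices

/-! ### The global Poincaré inequality and the abstract form of the theorem. -/

section Pattern

variable {d : ℕ} {Ω : Set (Eucl d)} {bc : BoundaryCondition}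

/-- Up to a null set, `Ω` is the disjoint union of finitely many convex cells of diameter at most
`D / M`, each of which contains a device with support of volume at least `c / Mᵈ`. -/
def HasConvexCells (Ω : Set (Eucl d)) (D c : ℝ) (M : ℕ) {ι : Type} (ω : ι → Set (Eucl d)) : Prop :=
  ∃ (J : Type) (_ : Fintype J) (C : J → Set (Eucl d)) (dev : J → ι),
    (∀ j, IsOpen (C j)) ∧ (∀ j, Convex ℝ (C j)) ∧ (∀ j, C j ⊆ Ω) ∧
    (Pairwise fun i j => Disjoint (C i) (C j)) ∧ volume (Ω \ ⋃ j, C j) = 0 ∧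
    (∀ j, ∀ x ∈ C j, ∀ z ∈ C j, ‖z - x‖ ≤ D / M) ∧
    (∀ j, ω (dev j) ⊆ C j) ∧ ∀ j, c / M ^ d ≤ volume.real (ω (dev j))

/-- Restricted to cells covering `Ω`, integrals add up. -/
theorem sum_setIntegral_cells {J : Type} [Fintype J] {C : J → Set (Eucl d)}
    (hCo : ∀ j, IsOpen (C j)) (hCΩ : ∀ j, C j ⊆ Ω)
    (hCd : Pairwise fun i j => Disjoint (C i) (C j)) (hcov : volume (Ω \ ⋃ j, C j) = 0)
    {f : Eucl d → ℝ} (hf : IntegrableOn f Ω) :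
    ∑ j, ∫ x in C j, f x = ∫ x in Ω, f x := by
  have h1 : ∫ x in ⋃ j, C j, f x = ∑ j, ∫ x in C j, f x :=
    integral_iUnion_fintype (fun j => (hCo j).measurableSet) hCd
      (fun j => hf.mono_set (hCΩ j))
  rw [← h1]
  refine setIntegral_congr_set ?_
  refine (LE.le.eventuallyLE (iUnion_subset hCΩ)).antisymm ?_
  exact ae_le_set.2 hcov

/-- The cell inequalities are summed. The ball of radius `D/M` and the lower bound on the device
volume both scale like `M⁻ᵈ`, so these powers cancel and `1/M²` remains only in front of the
gradient. -/
theorem HasConvexCells.sq_norm_inclH_le (hΩo : IsOpen Ω) (hΩ : volume Ω ≠ ⊤) {D c : ℝ} {M : ℕ}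
    (hD : 0 ≤ D) (hc : 0 < c) (hM : 1 ≤ M) {ι : Type} [Fintype ι] {ω : ι → Set (Eucl d)}
    (hω : IsDeviceFamily Ω ω) (h : HasConvexCells Ω D c M ω) (w : energySpace Ω bc) :
    ‖inclH Ω bc w‖ ^ 2 ≤ 2 * D ^ d * volume.real (Metric.ball (0 : Eucl d) 1) / c *
      (D ^ 2 / M ^ 2 * ‖weakGrad Ω bc w‖ ^ 2 +
        2 * inner ℝ (deviceAverage Ω ω (inclH Ω bc w)) (inclH Ω bc w)) := by
  obtain ⟨J, _, C, dev, hCo, hCc, hCΩ, hCd, hcov, hdiam, hdev, hvol⟩ := h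
  set y := inclH Ω bc w with hy
  set β := volume.real (Metric.ball (0 : Eucl d) 1) with hβ
  have hM0 : (0 : ℝ) < M := by exact_mod_cast hM
  have hball : volume.real (Metric.closedBall (0 : Eucl d) (D / M)) = D ^ d / M ^ d * β := by
    rw [measureReal_def, Measure.addHaar_closedBall _ _ (by positivity), ENNReal.toReal_mul,
      ENNReal.toReal_ofReal (by positivity), finrank_euclideanSpace_fin, div_pow, hβ,
      measureReal_def]
  have hyΩ : MemLp y 2 (volume.restrict Ω) := Lp.memLp y
  have hgΩ : ∀ i, MemLp (weakGrad Ω bc w i) 2 (volume.restrict Ω) := fun i => Lp.memLp _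
  have hβ0 : 0 ≤ β := measureReal_nonneg
  have hcell : ∀ j, c / 2 * ∫ x in C j, y x ^ 2 ≤
      (D ^ 2 / M ^ 2 * (∑ i, ∫ x in C j, weakGrad Ω bc w i x ^ 2) +
        2 * ((∫ x in ω (dev j), y x) ^ 2 / volume.real (ω (dev j)))) * (D ^ d * β) := by
    intro j
    have hμ := hω.volume_pos hΩ (dev j)
    have h1 := ((hasWeakGradient_weakGrad w).mono hΩo.measurableSet (hCΩ j)).integral_sq_le
      (hCo j) (hCc j) (Lp.stronglyMeasurable y).measurable
      (hyΩ.mono_measure (Measure.restrict_mono (hCΩ j) le_rfl))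
      (fun i => (hgΩ i).mono_measure (Measure.restrict_mono (hCΩ j) le_rfl))
      (hdiam j) (hdev j) hμ
    rw [hball] at h1
    have h0 : 0 ≤ ∫ x in C j, y x ^ 2 := integral_nonneg fun x => sq_nonneg _
    have h2 : c / M ^ d / 2 * ∫ x in C j, y x ^ 2 ≤
        volume.real (ω (dev j)) / 2 * ∫ x in C j, y x ^ 2 :=
      mul_le_mul_of_nonneg_right (by linarith [hvol j]) h0
    have h3 := mul_le_mul_of_nonneg_left (h2.trans h1) (pow_nonneg hM0.le d)
    refine (le_of_eq ?_).trans (h3.trans (le_of_eq ?_))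
    · field_simp
    · rw [div_pow]; field_simp
  have hsum := Finset.sum_le_sum fun j (_ : j ∈ Finset.univ) => hcell j
  have hyint : IntegrableOn (fun x => y x ^ 2) Ω := hyΩ.integrable_sq
  rw [← Finset.mul_sum, sum_setIntegral_cells hCo hCΩ hCd hcov hyint, ← Finset.sum_mul,
    Finset.sum_add_distrib, ← Finset.mul_sum, ← Finset.mul_sum, Finset.sum_comm] at hsum
  have hg : ∑ i, ∑ j, ∫ x in C j, weakGrad Ω bc w i x ^ 2 = ‖weakGrad Ω bc w‖ ^ 2 := by
    rw [sq_norm_weakGrad]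
    exact Finset.sum_congr rfl fun i _ =>
      sum_setIntegral_cells hCo hCΩ hCd hcov (hgΩ i).integrable_sq
  have hynorm : ∫ x in Ω, y x ^ 2 = ‖y‖ ^ 2 := by
    rw [← real_inner_self_eq_norm_sq, L2.inner_def]
    simp [sq]
  -- Distinct cells select distinct devices, so the selected averages form part of the full sum; the
  -- other devices add only nonnegative terms.
  have hinj : Function.Injective dev := by
    intro j j' hjj
    by_contra hne
    obtain ⟨x, hx⟩ := hω.nonempty (dev j)
    exact (hCd hne).le_bot ⟨hdev j hx, hdev j' (hjj ▸ hx)⟩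
  have hdevsum : ∑ j, (∫ x in ω (dev j), y x) ^ 2 / volume.real (ω (dev j)) ≤
      inner ℝ (deviceAverage Ω ω y) y := by
    rw [hω.inner_deviceAverage hΩ]
    classical
    rw [← Finset.sum_image (s := Finset.univ) (g := dev)
      (f := fun k => (∫ x in ω k, y x) ^ 2 / volume.real (ω k)) hinj.injOn]
    exact Finset.sum_le_sum_of_subset_of_nonneg (Finset.subset_univ _) fun k _ _ => by positivity
  rw [hg, hynorm] at hsum
  have hK : 0 ≤ D ^ d * β := by positivity
  have h4 : c / 2 * ‖y‖ ^ 2 ≤ (D ^ 2 / M ^ 2 * ‖weakGrad Ω bc w‖ ^ 2 +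
      2 * inner ℝ (deviceAverage Ω ω y) y) * (D ^ d * β) :=
    hsum.trans (mul_le_mul_of_nonneg_right (by linarith) hK)
  calc ‖y‖ ^ 2 = 2 / c * (c / 2 * ‖y‖ ^ 2) := by field_simp
    _ ≤ 2 / c * ((D ^ 2 / M ^ 2 * ‖weakGrad Ω bc w‖ ^ 2 +
      2 * inner ℝ (deviceAverage Ω ω y) y) * (D ^ d * β)) :=
        mul_le_mul_of_nonneg_left h4 (by positivity)
    _ = _ := by ring

/-- A family of device patterns with uniformly shaped convex cells. -/
structure IsUniformPattern (Ω : Set (Eucl d)) {ι : ℕ → Type} (ω : ∀ M, ι M → Set (Eucl d)) :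
    Prop where
  isDeviceFamily : ∀ M, 1 ≤ M → IsDeviceFamily Ω (ω M)
  exists_cells : ∃ D c : ℝ, 0 ≤ D ∧ 0 < c ∧ ∀ M, 1 ≤ M → HasConvexCells Ω D c M (ω M)

namespace IsUniformPattern

variable {ι κ : ℕ → Type} [∀ M, Fintype (ι M)] [∀ S, Fintype (κ S)]
  {ω : ∀ M, ι M → Set (Eucl d)} {ωm : ∀ S, κ S → Set (Eucl d)}

theorem exists_forall_le (hω : IsUniformPattern Ω ω) (hΩo : IsOpen Ω) (hΩ : volume Ω ≠ ⊤)
    {ν ϱ : ℝ} (hν : 0 < ν) (hϱ : 0 < ϱ) :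
    ∃ Mstar : ℕ, 1 ≤ Mstar ∧ ∀ M, Mstar ≤ M → ∃ lamStar : ℝ, 0 ≤ lamStar ∧
      ∀ lam : ℝ, lamStar ≤ lam → ∀ w : energySpace Ω bc,
        ϱ * ‖inclH Ω bc w‖ ^ 2 ≤ sqNormV Ω bc ν w +
          2 * (lam * inner ℝ (deviceAverage Ω (ω M) (inclH Ω bc w)) (inclH Ω bc w)) := by
  obtain ⟨D, c, hD, hc, hcells⟩ := hω.exists_cells
  set κ := 2 * D ^ d * volume.real (Metric.ball (0 : Eucl d) 1) / c with hκ
  have hκ0 : 0 ≤ κ := by positivity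
  -- For `M > N` this gives `ϱκD² ≤ νM ≤ νM²`, so the gradient term is absorbed by `ν‖∇w‖²`. The
  -- threshold `ϱκ` for `λ` does not depend on `M`.
  obtain ⟨N, hN⟩ := exists_nat_ge (ϱ * κ * D ^ 2 / ν)
  refine ⟨N + 1, by omega, fun M hM => ⟨ϱ * κ, by positivity, fun lam hlam w => ?_⟩⟩
  have hM1 : 1 ≤ M := by omega
  have hMN : (N : ℝ) ≤ M := by exact_mod_cast (by omega : N ≤ M)
  have hM1' : (1 : ℝ) ≤ M := by exact_mod_cast hM1
  have hdf := hω.isDeviceFamily M hM1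
  have h1 := (hcells M hM1).sq_norm_inclH_le hΩo hΩ hD hc hM1 hdf w
  set a := inner ℝ (deviceAverage Ω (ω M) (inclH Ω bc w)) (inclH Ω bc w) with ha
  have ha0 : 0 ≤ a := by rw [ha, hdf.inner_deviceAverage_eq_sq hΩ]; positivity
  have h2 : ϱ * κ * (D ^ 2 / M ^ 2) ≤ ν := by
    have h3 : ϱ * κ * D ^ 2 ≤ ν * M := by
      rw [div_le_iff₀ hν] at hN
      nlinarith
    rw [← mul_div_assoc, div_le_iff₀ (by positivity)]
    exact h3.trans (mul_le_mul_of_nonneg_left (by nlinarith) hν.le)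
  calc ϱ * ‖inclH Ω bc w‖ ^ 2
      ≤ ϱ * (κ * (D ^ 2 / M ^ 2 * ‖weakGrad Ω bc w‖ ^ 2 + 2 * a)) :=
        mul_le_mul_of_nonneg_left h1 hϱ.le
    _ = ϱ * κ * (D ^ 2 / M ^ 2) * ‖weakGrad Ω bc w‖ ^ 2 + 2 * (ϱ * κ * a) := by ring
    _ ≤ ν * ‖weakGrad Ω bc w‖ ^ 2 + 2 * (lam * a) := by gcongr
    _ ≤ sqNormV Ω bc ν w + 2 * (lam * a) := by
        unfold sqNormV
        linarith [sq_nonneg ‖inclH Ω bc w‖]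

theorem wellPosedDevices (hω : IsUniformPattern Ω ω) (hΩo : IsOpen Ω) (hΩ : volume Ω ≠ ⊤) :
    WellPosedDevices Ω bc ω :=
  ⟨fun M hM => (hω.isDeviceFamily M hM).isUnit_det_gram hΩ,
    fun _ hΦ M hM => isCompl_deviceSpan_auxSpan_orthogonal (hΦ M hM),
    fun M hM j => exists_isRegularizedIndicator ((hω.isDeviceFamily M hM).isOpen j)
      ((hω.isDeviceFamily M hM).nonempty j) ((hω.isDeviceFamily M hM).subset j),
    fun _ hΦ M hM => (hω.isDeviceFamily M hM).isCompl_auxSpan_of_isRegularizedIndicator hΩo hΩ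
      (hΦ M hM)⟩

theorem _root_.two_mul_diffusionOp_sub_pivot (ν : ℝ) (f : LTwo Ω) (w : energySpace Ω bc) :
    2 * (diffusionOp Ω bc ν w - pivot Ω bc f) w =
      2 * sqNormV Ω bc ν w - 2 * inner ℝ f (inclH Ω bc w) := by
  rw [sub_apply, diffusionOp_apply, real_inner_self_eq_norm_sq,
    real_inner_self_eq_norm_sq, sqNormV, mul_sub]
  rfl

theorem explicitOperatorsSatisfyAssumption (hω : IsUniformPattern Ω ω)
    (hωm : IsUniformPattern Ω ωm) (hΩo : IsOpen Ω) (hΩ : volume Ω ≠ ⊤) {ν : ℝ} (hν : 0 < ν) :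
    ExplicitOperatorsSatisfyAssumption Ω bc ν ω ωm := by
  refine ⟨hω.wellPosedDevices hΩo hΩ, hωm.wellPosedDevices hΩo hΩ, ?_⟩
  intro Φ Ψ hΦ hΨ K L hK hL ϱ hϱ
  constructor
  · obtain ⟨N, hN1, hN⟩ := hω.exists_forall_le (bc := bc) hΩo hΩ hν hϱ
    refine ⟨N, hN1, fun M hM => ?_⟩
    obtain ⟨l, hl0, hl⟩ := hN M hM
    refine ⟨l, hl0, fun lam hlam w => ?_⟩
    have h1 := hl lam hlam w
    have hdf := hω.isDeviceFamily M (hN1.trans hM)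
    rw [two_mul_diffusionOp_sub_pivot]
    rcases hK with rfl | rfl
    · have hc := hΦ M (hN1.trans hM)
      rw [hdf.inner_obliqueFeedback hΩ hc (isCompl_deviceSpan_auxSpan_orthogonal hc)]
      have := mul_le_mul_of_nonneg_left (hdf.inner_deviceAverage_le hΩ hc (inclH Ω bc w))
        (hl0.trans hlam)
      linarith
    · rw [hdf.inner_orthogonalFeedback hΩ]
      linarith
  · obtain ⟨N, hN1, hN⟩ := hωm.exists_forall_le (bc := bc) hΩo hΩ hν hϱ
    refine ⟨N, hN1, fun S hS => ?_⟩
    obtain ⟨l, hl0, hl⟩ := hN S hS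
    refine ⟨l, hl0, fun lam hlam w => ?_⟩
    have h1 := hl lam hlam w
    have hdf := hωm.isDeviceFamily S (hN1.trans hS)
    rw [two_mul_diffusionOp_sub_pivot]
    rcases hL with rfl | rfl
    · have hc := hΨ S (hN1.trans hS)
      rw [hdf.inner_obliqueInjection hΩ hc (isCompl_deviceSpan_auxSpan_orthogonal hc)]
      have := mul_le_mul_of_nonneg_left (hdf.inner_deviceAverage_le hΩ hc (inclH Ω bc w))
        (hl0.trans hlam)
      linarith
    · rw [inner_orthogonalInjection]
      linarith

end IsUniformPattern
end Pattern

/-! ### Null hyperplanes and measures of boxes. -/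

section LevelSets

variable {d : ℕ}

/-- The level set is a translate of a proper subspace. It serves to discard the faces between cells.
-/
theorem volume_level_set_eq_zero {L : Eucl d →ₗ[ℝ] ℝ} (hL : L ≠ 0) (q : ℝ) :
    volume {x : Eucl d | L x = q} = 0 := by
  obtain ⟨x₀, hx₀⟩ := LinearMap.surjective hL q
  have e : {x : Eucl d | L x = q} = (fun x => -x₀ + x) ⁻¹' (LinearMap.ker L : Set (Eucl d)) := by
    ext x
    simp only [mem_ofPred_eq, mem_preimage, SetLike.mem_coe, LinearMap.mem_ker, map_add, map_neg,
      hx₀, neg_add_eq_zero]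
    exact eq_comm
  rw [e, measure_preimage_add]
  exact Measure.addHaar_submodule _ _ (by rwa [ne_eq, LinearMap.ker_eq_top])

theorem norm_le_sum_abs (x : Eucl d) : ‖x‖ ≤ ∑ i, |x i| := by
  have hx : x = ∑ i, x i • EuclideanSpace.single i (1 : ℝ) := by
    ext j
    simp [Finset.sum_apply, Pi.single_apply]
  conv_lhs => rw [hx]
  refine (norm_sum_le _ _).trans (le_of_eq ?_)
  simp [norm_smul]

end LevelSets

section Boxes

variable {d : ℕ} {a b a' b' : Fin d → ℝ}

theorem isOpen_openRect (a b : Fin d → ℝ) : IsOpen (openRect a b) := by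
  have : openRect a b = ⋂ i, (fun x : Eucl d => x i) ⁻¹' Ioo (a i) (b i) := by
    ext x; simp [openRect]
  rw [this]
  exact isOpen_iInter_of_finite fun i => isOpen_Ioo.preimage (by fun_prop)

theorem convex_openRect (a b : Fin d → ℝ) : Convex ℝ (openRect a b) := by
  intro x hx y hy s t hs ht hst i
  exact convex_Ioo (a i) (b i) (hx i) (hy i) hs ht hst

theorem openRect_nonempty (h : ∀ i, a i < b i) : (openRect a b).Nonempty :=
  ⟨WithLp.toLp 2 fun i => (a i + b i) / 2, fun i => by
    constructor <;> simp only <;> linarith [h i]⟩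

theorem openRect_subset (ha : ∀ i, a' i ≤ a i) (hb : ∀ i, b i ≤ b' i) :
    openRect a b ⊆ openRect a' b' :=
  fun _ hx i => Ioo_subset_Ioo (ha i) (hb i) (hx i)

theorem disjoint_openRect {i : Fin d} (h : b i ≤ a' i) :
    Disjoint (openRect a b) (openRect a' b') :=
  disjoint_left.2 fun _ hx hx' => absurd ((hx i).2.trans_le h) (hx' i).1.not_gt

theorem volume_openRect (a b : Fin d → ℝ) :
    volume (openRect a b) = ∏ i, ENNReal.ofReal (b i - a i) := by
  rw [← Real.volume_pi_Ioo, ← (PiLp.volume_preserving_ofLp (Fin d)).measure_preimage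
    (MeasurableSet.univ_pi fun i => measurableSet_Ioo).nullMeasurableSet]
  congr 1
  ext x
  simp [openRect]

theorem volume_openRect_ne_top (a b : Fin d → ℝ) : volume (openRect a b) ≠ ⊤ := by
  rw [volume_openRect]
  exact ENNReal.prod_ne_top fun i _ => ENNReal.ofReal_ne_top

theorem volume_real_openRect (h : ∀ i, a i ≤ b i) :
    volume.real (openRect a b) = ∏ i, (b i - a i) := by
  rw [measureReal_def, volume_openRect, ENNReal.toReal_prod]
  exact Finset.prod_congr rfl fun i _ => ENNReal.toReal_ofReal (sub_nonneg.2 (h i))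

end Boxes

/-! ### The chessboard pattern. -/

section Chessboard

variable {d : ℕ} {a b : Fin d → ℝ} {p : ChessPlacement d} {parity M : ℕ}

theorem chessSupport_eq_openRect (c : ChessIndex d M parity) :
    chessSupport a b p parity M c = openRect
      (fun i => a i + (b i - a i) / M * ((c.1 i : ℝ) + ((c.2.1 i : ℝ) + p.lo c.2.1 i) / 2))
      (fun i => a i + (b i - a i) / M * ((c.1 i : ℝ) + ((c.2.1 i : ℝ) + p.hi c.2.1 i) / 2)) :=
  rfl

theorem add_div_mul_natCast {a b : ℝ} {M : ℕ} (hM : 1 ≤ M) : a + (b - a) / M * M = b := by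
  have : (M : ℝ) ≠ 0 := by positivity
  field_simp; ring

theorem isDeviceFamily_chessSupport (hab : ∀ i, a i < b i) (hM : 1 ≤ M) :
    IsDeviceFamily (openRect a b) (chessSupport a b p parity M) := by
  have hM0 : (0 : ℝ) < M := by exact_mod_cast hM
  have hL : ∀ i, 0 < (b i - a i) / M := fun i => div_pos (sub_pos.2 (hab i)) hM0
  refine ⟨fun c => isOpen_openRect _ _, fun c => ?_, fun c => ?_, fun c c' hcc => ?_⟩
  · refine openRect_nonempty fun i => ?_
    have := p.lo_lt_hi c.2.1 i
    have := hL i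
    gcongr
  · refine openRect_subset (fun i => ?_) fun i => ?_
    · have := p.lo_nonneg c.2.1 i
      have := hL i
      simp only [le_add_iff_nonneg_right]
      positivity
    · have h1 := p.hi_le_one c.2.1 i
      have h2 : ((c.2.1 i : ℕ) : ℝ) ≤ 1 := by exact_mod_cast (by omega : (c.2.1 i : ℕ) ≤ 1)
      have h3 : ((c.1 i : ℕ) : ℝ) + 1 ≤ M := by exact_mod_cast (c.1 i).2
      conv_rhs => rw [← add_div_mul_natCast (a := a i) (b := b i) hM]
      have := hL i
      gcongr
      linarith
  -- The integer `2 zᵢ + eᵢ` is the position of the square in direction `i`. Different squares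
  -- differ in one such position and are separated by a coordinate hyperplane.
  · have key : ∀ c c' : ChessIndex d M parity, ∀ i,
        2 * (c.1 i : ℕ) + (c.2.1 i : ℕ) < 2 * (c'.1 i : ℕ) + (c'.2.1 i : ℕ) →
        Disjoint (chessSupport a b p parity M c) (chessSupport a b p parity M c') := by
      intro c c' i h
      refine disjoint_openRect (i := i) ?_
      have h1 : 2 * ((c.1 i : ℕ) : ℝ) + ((c.2.1 i : ℕ) : ℝ) + 1 ≤
          2 * ((c'.1 i : ℕ) : ℝ) + ((c'.2.1 i : ℕ) : ℝ) := by exact_mod_cast h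
      have h2 := p.hi_le_one c.2.1 i
      have h3 := p.lo_nonneg c'.2.1 i
      have := hL i
      gcongr a i + _ * ?_
      linarith
    have hne : ∃ i, 2 * (c.1 i : ℕ) + (c.2.1 i : ℕ) ≠ 2 * (c'.1 i : ℕ) + (c'.2.1 i : ℕ) := by
      by_contra! h
      refine hcc (Prod.ext (funext fun i => ?_) (Subtype.ext (funext fun i => ?_)))
      · have := h i
        apply Fin.ext
        omega
      · have := h i
        apply Fin.ext
        omega
    obtain ⟨i, hi⟩ := hne
    rcases hi.lt_or_gt with h | h
    · exact key c c' i h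
    · exact (key c' c i h).symm

/-- A rescaled copy of the box. -/
def boxCell (a b : Fin d → ℝ) (M : ℕ) (z : Fin d → Fin M) : Set (Eucl d) :=
  openRect (fun i => a i + (b i - a i) / M * (z i : ℕ))
    (fun i => a i + (b i - a i) / M * ((z i : ℕ) + 1))

/-- Off the grid hyperplanes, the integer parts of the rescaled coordinates name the cell containing
the point. -/
theorem volume_openRect_diff_boxCell (hab : ∀ i, a i < b i) (hM : 1 ≤ M) :
    volume (openRect a b \ ⋃ z, boxCell a b M z) = 0 := by
  have hM0 : (0 : ℝ) < M := by exact_mod_cast hM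
  have hL : ∀ i, 0 < (b i - a i) / M := fun i => div_pos (sub_pos.2 (hab i)) hM0
  have hnull : volume (⋃ (i : Fin d) (k : ℕ),
      {x : Eucl d | x i = a i + (b i - a i) / M * k}) = 0 := by
    refine measure_iUnion_null fun i => measure_iUnion_null fun k => ?_
    refine volume_level_set_eq_zero (L := (EuclideanSpace.proj i : Eucl d →L[ℝ] ℝ).toLinearMap) ?_ _
    intro h
    have := LinearMap.congr_fun h (EuclideanSpace.single i 1)
    simp at this
  refine measure_mono_null ?_ hnull
  rintro x ⟨hx, hxz⟩
  by_contra hx'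
  simp only [mem_iUnion, mem_ofPred_eq, not_exists] at hx'
  refine hxz (mem_iUnion.2 ?_)
  have hu : ∀ i, 0 < (x i - a i) / ((b i - a i) / M) := fun i =>
    div_pos (sub_pos.2 (hx i).1) (hL i)
  have hfl : ∀ i, ⌊(x i - a i) / ((b i - a i) / M)⌋₊ < M := by
    intro i
    rw [Nat.floor_lt (hu i).le, div_lt_iff₀ (hL i)]
    have := (hx i).2
    have := add_div_mul_natCast (a := a i) (b := b i) hM
    linarith
  refine ⟨fun i => ⟨_, hfl i⟩, fun i => ⟨?_, ?_⟩⟩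
  · refine lt_of_le_of_ne ?_ (Ne.symm (hx' i _))
    have := Nat.floor_le (hu i).le
    rw [le_div_iff₀ (hL i)] at this
    linarith
  · have := Nat.lt_floor_add_one ((x i - a i) / ((b i - a i) / M))
    rw [div_lt_iff₀ (hL i)] at this
    simp only
    linarith

/-- The cells are whole rescaled copies of the box, not single squares. One device per copy
suffices, always in the square `e₀`; `D` is the `ℓ¹` size of the box and `c` is the volume of that
device for `M = 1`. -/
theorem isUniformPattern_chessSupport (hab : ∀ i, a i < b i) (p : ChessPlacement d)
    (e₀ : {e : Fin d → Fin 2 // (∑ i, (e i : ℕ)) % 2 = parity}) :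
    IsUniformPattern (openRect a b) (chessSupport a b p parity) := by
  refine ⟨fun M hM => isDeviceFamily_chessSupport hab hM, ∑ i, (b i - a i),
    ∏ i, ((b i - a i) * ((p.hi e₀.1 i - p.lo e₀.1 i) / 2)),
    Finset.sum_nonneg fun i _ => (sub_pos.2 (hab i)).le,
    Finset.prod_pos fun i _ => mul_pos (sub_pos.2 (hab i))
      (half_pos (sub_pos.2 (p.lo_lt_hi _ i))), fun M hM => ?_⟩
  have hM0 : (0 : ℝ) < M := by exact_mod_cast hM
  have hL : ∀ i, 0 < (b i - a i) / M := fun i => div_pos (sub_pos.2 (hab i)) hM0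
  refine ⟨Fin d → Fin M, inferInstance, boxCell a b M, fun z => (z, e₀),
    fun z => isOpen_openRect _ _, fun z => convex_openRect _ _, fun z => ?_, fun z z' hz => ?_,
    volume_openRect_diff_boxCell hab hM, fun z x hx y hy => ?_, fun z => ?_, fun z => ?_⟩
  · refine openRect_subset (fun i => ?_) fun i => ?_
    · have := hL i
      simp only [le_add_iff_nonneg_right]
      positivity
    · have h3 : ((z i : ℕ) : ℝ) + 1 ≤ M := by exact_mod_cast (z i).2
      conv_rhs => rw [← add_div_mul_natCast (a := a i) (b := b i) hM]
      have := hL i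
      gcongr
  · have key : ∀ z z' : Fin d → Fin M, ∀ i, z i < z' i →
        Disjoint (boxCell a b M z) (boxCell a b M z') := by
      intro z z' i h
      refine disjoint_openRect (i := i) ?_
      have h1 : ((z i : ℕ) : ℝ) + 1 ≤ (z' i : ℕ) := by exact_mod_cast h
      have := hL i
      gcongr
    obtain ⟨i, hi⟩ := Function.ne_iff.1 hz
    rcases hi.lt_or_gt with h | h
    · exact key z z' i h
    · exact (key z' z i h).symm
  · refine (norm_le_sum_abs _).trans ?_
    rw [Finset.sum_div]
    refine Finset.sum_le_sum fun i _ => ?_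
    have h1 := hx i
    have h2 := hy i
    simp only [mem_Ioo, mul_add, mul_one] at h1 h2
    rw [PiLp.sub_apply, abs_le]
    constructor <;> linarith [h1.1, h1.2, h2.1, h2.2]
  · refine openRect_subset (fun i => ?_) fun i => ?_
    · have := hL i
      have := p.lo_nonneg e₀.1 i
      simp only
      gcongr
      simp only [le_add_iff_nonneg_right]
      positivity
    · have := hL i
      have h1 := p.hi_le_one e₀.1 i
      have h2 : ((e₀.1 i : ℕ) : ℝ) ≤ 1 := by exact_mod_cast (by omega : (e₀.1 i : ℕ) ≤ 1)
      simp only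
      gcongr
      linarith
  · rw [chessSupport_eq_openRect, volume_real_openRect]
    · refine le_of_eq ?_
      have : (M : ℝ) ^ d = ∏ _i : Fin d, (M : ℝ) := by simp
      rw [this, ← Finset.prod_div_distrib]
      refine Finset.prod_congr rfl fun i _ => ?_
      ring
    · intro i
      have := p.lo_lt_hi e₀.1 i
      have := hL i
      simp only
      gcongr

/-- In dimension zero there would be no square of the second colour. -/
theorem exists_chess_parity_one (hd : 0 < d) :
    ∃ e : Fin d → Fin 2, (∑ i, (e i : ℕ)) % 2 = 1 := by
  refine ⟨Pi.single ⟨0, hd⟩ 1, ?_⟩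
  rw [Finset.sum_eq_single ⟨0, hd⟩] <;> simp +contextual

end Chessboard

/-! ### Edgewise subdivision in Kuhn coordinates. -/

section Kuhn

variable {d : ℕ}

theorem isOpen_kuhnSimplex (π : Equiv.Perm (Fin d)) : IsOpen (kuhnSimplex π) := by
  have : kuhnSimplex π = (⋂ i, (fun x : Fin d → ℝ => x i) ⁻¹' Ioo 0 1) ∩
      ⋂ (i) (j) (_ : i < j), {x : Fin d → ℝ | x (π j) < x (π i)} := by
    ext x; simp [kuhnSimplex]
  rw [this]
  refine (isOpen_iInter_of_finite fun i => isOpen_Ioo.preimage (continuous_apply i)).inter ?_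
  exact isOpen_iInter_of_finite fun i => isOpen_iInter_of_finite fun j =>
    isOpen_iInter_of_finite fun _ => isOpen_lt (continuous_apply _) (continuous_apply _)

theorem convex_kuhnSimplex (π : Equiv.Perm (Fin d)) : Convex ℝ (kuhnSimplex π) := by
  intro x hx y hy s t hs ht hst
  refine ⟨fun i => convex_Ioo 0 1 (hx.1 i) (hy.1 i) hs ht hst, fun i j hij => ?_⟩
  have h1 := hx.2 i j hij
  have h2 := hy.2 i j hij
  simp only [Pi.add_apply, Pi.smul_apply, smul_eq_mul]
  rcases hs.eq_or_lt with rfl | hs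
  · rw [zero_add] at hst; subst hst; linarith
  · nlinarith

/-- The closed Kuhn simplex of the identity. -/
def closedKuhnSimplex (d : ℕ) : Set (Fin d → ℝ) :=
  {x | (∀ i, x i ∈ Icc (0 : ℝ) 1) ∧ Antitone x}

theorem convex_closedKuhnSimplex : Convex ℝ (closedKuhnSimplex d) := by
  intro x hx y hy s t hs ht hst
  refine ⟨fun i => convex_Icc 0 1 (hx.1 i) (hy.1 i) hs ht hst, fun i j hij => ?_⟩
  have h1 := hx.2 hij
  have h2 := hy.2 hij
  simp only [Pi.add_apply, Pi.smul_apply, smul_eq_mul]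
  gcongr

theorem kuhnSimplex_refl_subset : kuhnSimplex (Equiv.refl (Fin d)) ⊆ closedKuhnSimplex d := by
  intro x hx
  refine ⟨fun i => Ioo_subset_Icc_self (hx.1 i), fun i j hij => ?_⟩
  rcases hij.eq_or_lt with rfl | h
  · exact le_rfl
  · exact (hx.2 i j h).le

/-- A cell of the grid of mesh size `1 / M` in Kuhn coordinates. -/
def kuhnCell (M : ℕ) (z : Fin d → Fin M) (π : Equiv.Perm (Fin d)) : Set (Fin d → ℝ) :=
  {y | (fun i => M * y i - (z i : ℕ)) ∈ kuhnSimplex π}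

variable {M : ℕ} {z z' : Fin d → Fin M} {π π' : Equiv.Perm (Fin d)}

theorem isOpen_kuhnCell : IsOpen (kuhnCell M z π) :=
  (isOpen_kuhnSimplex π).preimage (by fun_prop)

theorem convex_kuhnCell : Convex ℝ (kuhnCell M z π) := by
  intro x hx y hy s t hs ht hst
  have := convex_kuhnSimplex π hx hy hs ht hst
  rw [kuhnCell, mem_ofPred_eq]
  convert this using 1
  ext i
  simp only [Pi.add_apply, Pi.smul_apply, smul_eq_mul]
  linear_combination (z i : ℝ) * hst

theorem abs_sub_le_of_mem_kuhnCell (hM : 1 ≤ M) {x y : Fin d → ℝ} (hx : x ∈ kuhnCell M z π)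
    (hy : y ∈ kuhnCell M z π) (i : Fin d) : |y i - x i| ≤ 1 / M := by
  have hM0 : (0 : ℝ) < M := by exact_mod_cast hM
  have h1 := hx.1 i
  have h2 := hy.1 i
  simp only [mem_Ioo] at h1 h2
  have h3 : |(y i - x i) * M| ≤ 1 := by
    rw [abs_le]
    constructor <;> linarith [h1.1, h1.2, h2.1, h2.2]
  rwa [le_div_iff₀ hM0, ← Nat.abs_cast M, ← abs_mul]

/-- A point determines its cell: `z` consists of the integer parts of `M y`, and `π` is the unique
ordering that makes the fractional parts decrease. -/
theorem disjoint_kuhnCell (h : (z, π) ≠ (z', π')) :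
    Disjoint (kuhnCell M z π) (kuhnCell M z' π') := by
  refine disjoint_left.2 fun y hy hy' => h ?_
  have hz : z = z' := by
    ext i
    have h1 := hy.1 i
    have h2 := hy'.1 i
    simp only [mem_Ioo] at h1 h2
    have h3 : ((z i : ℕ) : ℝ) < (z' i : ℕ) + 1 := by linarith [h1.1, h2.2]
    have h4 : ((z' i : ℕ) : ℝ) < (z i : ℕ) + 1 := by linarith [h1.2, h2.1]
    norm_cast at h3 h4
    omega
  subst hz
  have hanti : ∀ {ρ : Equiv.Perm (Fin d)}, y ∈ kuhnCell M z ρ →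
      StrictAnti ((fun i => M * y i - (z i : ℕ)) ∘ ρ) := fun h i j hij => h.2 i j hij
  have h5 : (fun i => M * y i - (z i : ℕ) : Fin d → ℝ) ∘ π =
      (fun i => M * y i - (z i : ℕ)) ∘ π' :=
    ((hanti hy).range_inj (hanti hy')).1 (by
      rw [π.surjective.range_comp, π'.surjective.range_comp])
  have hinj : Function.Injective (fun i => M * y i - (z i : ℕ) : Fin d → ℝ) := by
    have := (hanti hy).injective
    rwa [Equiv.injective_comp] at this
  have h6 : π = π' := Equiv.ext fun i => hinj (congrFun h5 i)
  rw [h6]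

theorem kuhnCell_subset (hM : 1 ≤ M) (c : EdgewiseCell d M) :
    kuhnCell M c.1.1 c.1.2 ⊆ kuhnSimplex (Equiv.refl (Fin d)) := by
  intro y hy
  have hM0 : (M : ℝ) ≠ 0 := by positivity
  have := c.2 _ hy
  convert this using 1
  ext i
  field_simp
  ring

/-- A point in general position of the Kuhn simplex lies in a cell of its edgewise subdivision. -/
theorem exists_mem_kuhnCell (hM : 1 ≤ M) {y : Fin d → ℝ} (hy : y ∈ closedKuhnSimplex d)
    (h1 : ∀ i (k : ℤ), M * y i ≠ k) (h2 : ∀ i j, i ≠ j → ∀ k : ℤ, M * y i - M * y j ≠ k) :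
    ∃ c : EdgewiseCell d M, y ∈ kuhnCell M c.1.1 c.1.2 := by
  have hM0 : (0 : ℝ) < M := by exact_mod_cast hM
  have h0 : ∀ i, 0 ≤ M * y i := fun i => mul_nonneg hM0.le (hy.1 i).1
  have hlt : ∀ i, ⌊M * y i⌋₊ < M := fun i => by
    rw [Nat.floor_lt (h0 i)]
    refine lt_of_le_of_ne ?_ (by exact_mod_cast h1 i M)
    nlinarith [(hy.1 i).2]
  set z : Fin d → Fin M := fun i => ⟨_, hlt i⟩ with hz
  set u : Fin d → ℝ := fun i => M * y i - (z i : ℕ) with hu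
  have hu01 : ∀ i, u i ∈ Ioo (0 : ℝ) 1 := fun i => by
    constructor
    · refine lt_of_le_of_ne (sub_nonneg.2 (Nat.floor_le (h0 i))) fun h => h1 i (z i : ℕ) ?_
      push_cast
      linarith
    · have := Nat.lt_floor_add_one (M * y i)
      simp only [hu, hz]
      linarith
  have huinj : Function.Injective u := by
    intro i j hij
    by_contra hne
    refine h2 i j hne ((z i : ℕ) - (z j : ℕ)) ?_
    push_cast
    simp only [hu] at hij
    linarith
  -- The permutation listing the fractional parts in decreasing order; general position makes the
  -- order strict.
  set π := Tuple.sort (fun i => -u i)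
  have hπ : ∀ i j, i < j → u (π j) < u (π i) := by
    intro i j hij
    have := Tuple.monotone_sort (fun i => -u i) hij.le
    simp only [Function.comp_apply, neg_le_neg_iff] at this
    refine lt_of_le_of_ne this fun h => ?_
    exact hij.ne' (π.injective (huinj h))
  refine ⟨⟨(z, π), fun x hx => ⟨fun i => ?_, fun i j hij => ?_⟩⟩, hu01, hπ⟩
  · have := hx.1 i
    have h3 : ((z i : ℕ) : ℝ) + 1 ≤ M := by exact_mod_cast (z i).2
    constructor
    · have := this.1
      positivity
    · rw [div_lt_one hM0]
      linarith [this.2]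
  · simp only [Equiv.refl_apply]
    gcongr ?_ / _
    -- The whole cell must lie in the Kuhn simplex. As `y` is antitone, so are its integer parts. If
    -- two of them differ, the order holds on the entire cell; if they agree, the fractional parts
    -- of `y` are ordered, so `π` lists `i` before `j` and imposes the order on the cell.
    have hle : (z j : ℕ) ≤ (z i : ℕ) := Nat.floor_le_floor
      (mul_le_mul_of_nonneg_left (hy.2 hij.le) hM0.le)
    rcases hle.lt_or_eq with h | h
    · have : ((z j : ℕ) : ℝ) + 1 ≤ (z i : ℕ) := by exact_mod_cast h
      linarith [(hx.1 i).1, (hx.1 j).2]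
    · have huij : u j < u i := by
        refine lt_of_le_of_ne ?_ fun e => hij.ne' (huinj e)
        have := mul_le_mul_of_nonneg_left (hy.2 hij.le) hM0.le
        simp only [hu, h]
        linarith
      rw [h]
      obtain ⟨a, rfl⟩ := π.surjective i
      obtain ⟨b, rfl⟩ := π.surjective j
      have hab : a < b := by
        by_contra! hba
        rcases hba.eq_or_lt with rfl | hba
        · exact lt_irrefl _ huij
        · exact (hπ _ _ hba).not_gt huij
      have := hx.2 a b hab
      linarith

end Kuhn

/-! ### From Kuhn coordinates to an arbitrary simplex. -/

section EdgeMap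

variable {d : ℕ}

/-- Induction on the dimension: the point equals `(1 - x₀) v₀ + x₀ p`, where `p` is the point of the
face opposite `v₀` with coordinates `xᵢ₊₁ / x₀`. If `x₀ = 0`, monotonicity forces `x = 0`. -/
theorem add_sum_smul_sub_mem_convexHull {E : Type*} [AddCommGroup E] [Module ℝ E] {n : ℕ}
    (v : Fin (n + 1) → E) {x : Fin n → ℝ} (hx : x ∈ closedKuhnSimplex n) :
    v 0 + ∑ i, x i • (v i.succ - v i.castSucc) ∈ convexHull ℝ (range v) := by
  induction n with
  | zero => simpa using subset_convexHull ℝ _ (mem_range_self 0)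
  | succ n ih =>
    rw [Fin.sum_univ_succ]
    have h0 : v 0 ∈ convexHull ℝ (range v) := subset_convexHull ℝ _ (mem_range_self 0)
    rcases (hx.1 0).1.eq_or_lt with hx0 | hx0
    · have : ∀ i, x i = 0 := fun i => le_antisymm (hx0 ▸ hx.2 (Fin.zero_le i)) (hx.1 i).1
      simpa [this] using h0
    · have hx' : (fun i : Fin n => x i.succ / x 0) ∈ closedKuhnSimplex n := by
        refine ⟨fun i => ⟨div_nonneg (hx.1 _).1 hx0.le, ?_⟩, fun i j hij => ?_⟩
        · exact (div_le_one hx0).2 (hx.2 (Fin.zero_le _))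
        · exact div_le_div_of_nonneg_right (hx.2 (Fin.succ_le_succ_iff.2 hij)) hx0.le
      have h1 := ih (fun i => v i.succ) hx'
      have h2 := convexHull_mono (𝕜 := ℝ) (range_comp_subset_range Fin.succ v) h1
      have h3 := convex_convexHull ℝ (range v) h0 h2 (sub_nonneg.2 (hx.1 0).2) hx0.le (by ring)
      convert h3 using 1
      rw [smul_add, Finset.smul_sum]
      simp_rw [smul_smul, mul_div_cancel₀ _ hx0.ne']
      simp only [Fin.castSucc_zero, Fin.succ_zero_eq_one, Fin.succ_castSucc]
      module

/-- The linear map `edgeMap`. -/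
def edgeLinearMap (v : Fin (d + 1) → Eucl d) : (Fin d → ℝ) →ₗ[ℝ] Eucl d :=
  Fintype.linearCombination ℝ fun i : Fin d => v i.succ - v i.castSucc

theorem edgeLinearMap_apply (v : Fin (d + 1) → Eucl d) (x : Fin d → ℝ) :
    edgeLinearMap v x = edgeMap v x := rfl

/-- The sum of the first `k` edges telescopes, so the coordinates are `k` ones followed by zeros. -/
theorem exists_edgeLinearMap_eq (v : Fin (d + 1) → Eucl d) (k : Fin (d + 1)) :
    ∃ x ∈ closedKuhnSimplex d, edgeLinearMap v x = v k - v 0 := by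
  refine ⟨fun i => if i.castSucc < k then 1 else 0, ⟨fun i => ?_, fun i j hij => ?_⟩, ?_⟩
  · simp only; split_ifs <;> simp
  · have : i.castSucc ≤ j.castSucc := hij
    simp only
    split_ifs with h1 h2
    · exact le_rfl
    · exact absurd (this.trans_lt h1) h2
    · exact zero_le_one
    · exact le_rfl
  · rw [edgeLinearMap_apply, edgeMap]
    induction k using Fin.induction with
    | zero => simp
    | succ k ih =>
      have : ∀ i : Fin d, (if i.castSucc < k.succ then (1 : ℝ) else 0) =
          (if i.castSucc < k.castSucc then (1 : ℝ) else 0) + if i = k then 1 else 0 := by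
        intro i
        simp only [Fin.castSucc_lt_succ_iff, Fin.castSucc_lt_castSucc_iff]
        rcases lt_trichotomy i k with h | h | h
        · simp [h, h.le, h.ne]
        · simp [h]
        · simp [h.not_ge, h.not_gt, h.ne']
      simp_rw [this, add_smul, Finset.sum_add_distrib, ih]
      simp

theorem edgeLinearMap_bijective {v : Fin (d + 1) → Eucl d} (hv : AffineIndependent ℝ v) :
    Function.Bijective (edgeLinearMap v) := by
  have hs : Function.Surjective (edgeLinearMap v) := by
    rw [← LinearMap.range_eq_top, eq_top_iff,
      ← hv.vectorSpan_eq_top_of_card_eq_finrank_add_one (by simp),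
      vectorSpan_range_eq_span_range_vsub_right ℝ v 0, Submodule.span_le]
    rintro _ ⟨k, rfl⟩
    obtain ⟨x, -, hx⟩ := exists_edgeLinearMap_eq v k
    exact ⟨x, hx⟩
  exact ⟨(LinearMap.injective_iff_surjective_of_finrank_eq_finrank (by simp)).2 hs, hs⟩

/-- The invertible linear map `edgeMap` of a nondegenerate simplex. -/
noncomputable def edgeEquiv {v : Fin (d + 1) → Eucl d} (hv : AffineIndependent ℝ v) :
    (Fin d → ℝ) ≃L[ℝ] Eucl d :=
  (LinearEquiv.ofBijective (edgeLinearMap v) (edgeLinearMap_bijective hv)).toContinuousLinearEquiv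

theorem edgeEquiv_apply {v : Fin (d + 1) → Eucl d} (hv : AffineIndependent ℝ v) (x : Fin d → ℝ) :
    edgeEquiv hv x = edgeMap v x := rfl

/-- The affine homeomorphism from Kuhn coordinates to the simplex. -/
noncomputable def kuhnHomeo {v : Fin (d + 1) → Eucl d} (hv : AffineIndependent ℝ v) :
    (Fin d → ℝ) ≃ₜ Eucl d :=
  (edgeEquiv hv).toHomeomorph.trans (Homeomorph.addLeft (v 0))

theorem kuhnHomeo_apply {v : Fin (d + 1) → Eucl d} (hv : AffineIndependent ℝ v)
    (x : Fin d → ℝ) : kuhnHomeo hv x = v 0 + edgeMap v x := rfl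

theorem kuhnHomeo_eq_image {v : Fin (d + 1) → Eucl d} (hv : AffineIndependent ℝ v)
    (s : Set (Fin d → ℝ)) : kuhnHomeo hv '' s = (fun x => v 0 + x) '' (edgeEquiv hv '' s) := by
  rw [image_image]; rfl

theorem Convex.kuhnHomeo_image {v : Fin (d + 1) → Eucl d} (hv : AffineIndependent ℝ v)
    {s : Set (Fin d → ℝ)} (hs : Convex ℝ s) : Convex ℝ (kuhnHomeo hv '' s) := by
  rw [kuhnHomeo_eq_image]
  exact (hs.is_linear_image (edgeEquiv hv).toLinearEquiv.toLinearMap.isLinear).translate _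

theorem convexHull_subset_kuhnHomeo_image {v : Fin (d + 1) → Eucl d}
    (hv : AffineIndependent ℝ v) :
    convexHull ℝ (range v) ⊆ kuhnHomeo hv '' closedKuhnSimplex d := by
  refine convexHull_min ?_ (convex_closedKuhnSimplex.kuhnHomeo_image hv)
  rintro _ ⟨k, rfl⟩
  obtain ⟨x, hx, hxk⟩ := exists_edgeLinearMap_eq v k
  exact ⟨x, hx, by rw [kuhnHomeo_apply, ← edgeLinearMap_apply, hxk]; abel⟩

theorem kuhnHomeo_image_subset_interior {v : Fin (d + 1) → Eucl d}
    (hv : AffineIndependent ℝ v) :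
    kuhnHomeo hv '' kuhnSimplex (Equiv.refl (Fin d)) ⊆ interior (convexHull ℝ (range v)) := by
  refine interior_maximal ?_ ((kuhnHomeo hv).isOpenMap _ (isOpen_kuhnSimplex _))
  rintro _ ⟨x, hx, rfl⟩
  exact add_sum_smul_sub_mem_convexHull v (kuhnSimplex_refl_subset hx)

theorem norm_edgeMap_le (v : Fin (d + 1) → Eucl d) {x : Fin d → ℝ} {r : ℝ}
    (hx : ∀ i, |x i| ≤ r) : ‖edgeMap v x‖ ≤ r * ∑ i : Fin d, ‖v i.succ - v i.castSucc‖ := by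
  rw [edgeMap, Finset.mul_sum]
  refine (norm_sum_le _ _).trans (Finset.sum_le_sum fun i _ => ?_)
  rw [norm_smul]
  exact mul_le_mul_of_nonneg_right (hx i) (norm_nonneg _)

/-- The part of a simplex outside the cells of its edgewise subdivision is a null set. -/
theorem volume_convexHull_diff_cells {v : Fin (d + 1) → Eucl d} (hv : AffineIndependent ℝ v)
    {M : ℕ} (hM : 1 ≤ M) :
    volume (convexHull ℝ (range v) \
      ⋃ c : EdgewiseCell d M, kuhnHomeo hv '' kuhnCell M c.1.1 c.1.2) = 0 := by
  have hM0 : (M : ℝ) ≠ 0 := by positivity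
  let L : Fin d → Eucl d →ₗ[ℝ] ℝ := fun i =>
    (LinearMap.proj i) ∘ₗ (edgeEquiv hv).symm.toLinearEquiv.toLinearMap
  have hL : ∀ i y, L i (kuhnHomeo hv y) = L i (v 0) + y i := by
    intro i y
    rw [kuhnHomeo_apply, map_add, ← edgeEquiv_apply hv]
    simp [L]
  have hL' : ∀ i y, L i (edgeEquiv hv y) = y i := fun i y => by simp [L]
  -- The points not in general position, those with some `M yᵢ` or `M yᵢ - M yⱼ` an integer, lie in
  -- countably many hyperplanes.
  have hnull : volume ((⋃ (i : Fin d) (k : ℤ), {x : Eucl d | L i x = L i (v 0) + k / M}) ∪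
      ⋃ (i : Fin d) (j : Fin d) (_ : i ≠ j) (k : ℤ),
        {x : Eucl d | (L i - L j) x = L i (v 0) - L j (v 0) + k / M}) = 0 := by
    refine measure_union_null (measure_iUnion_null fun i => measure_iUnion_null fun k => ?_)
      (measure_iUnion_null fun i => measure_iUnion_null fun j => measure_iUnion_null fun hij =>
        measure_iUnion_null fun k => ?_)
    · refine volume_level_set_eq_zero (fun h => ?_) _
      have := LinearMap.congr_fun h (edgeEquiv hv (Pi.single i 1))
      simp [hL'] at this
    · refine volume_level_set_eq_zero (fun h => ?_) _
      have := LinearMap.congr_fun h (edgeEquiv hv (Pi.single i 1))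
      simp [hL', hij.symm] at this
  refine measure_mono_null ?_ hnull
  rintro x ⟨hx, hxc⟩
  obtain ⟨y, hy, rfl⟩ := convexHull_subset_kuhnHomeo_image hv hx
  by_contra hn
  simp only [mem_union, mem_iUnion, mem_ofPred_eq, not_or, not_exists, LinearMap.sub_apply,
    hL] at hn
  refine hxc ?_
  have h1 : ∀ i (k : ℤ), M * y i ≠ k := fun i k hk => hn.1 i k (by rw [← hk]; field_simp)
  have h2 : ∀ i j, i ≠ j → ∀ k : ℤ, M * y i - M * y j ≠ k := fun i j hij k hk =>
    hn.2 i j hij k (by rw [← hk]; field_simp; ring)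
  obtain ⟨c, hc⟩ := exists_mem_kuhnCell hM hy h1 h2
  exact mem_iUnion.2 ⟨c, mem_image_of_mem _ hc⟩

end EdgeMap

theorem exists_pos_forall_le_of_finite {α : Type*} [Finite α] {f : α → ℝ} (hf : ∀ i, 0 < f i) :
    ∃ c, 0 < c ∧ ∀ i, c ≤ f i := by
  cases isEmpty_or_nonempty α
  · exact ⟨1, one_pos, fun i => isEmptyElim i⟩
  · obtain ⟨i, hi⟩ := Finite.exists_min f
    exact ⟨f i, hf i, hi⟩

/-! ### Rescaled patterns in convex polytopal domains. -/

section RescaledCopies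

variable {d : ℕ} {Ω : Set (Eucl d)}

theorem IsConvexPolytopalDomain.isOpen (hΩ : IsConvexPolytopalDomain Ω) : IsOpen Ω := by
  obtain ⟨-, s, rfl⟩ := hΩ
  exact isOpen_interior

theorem IsConvexPolytopalDomain.volume_ne_top (hΩ : IsConvexPolytopalDomain Ω) :
    volume Ω ≠ ⊤ := by
  obtain ⟨-, s, rfl⟩ := hΩ
  exact (((isBounded_convexHull.2 s.finite_toSet.isBounded).subset
    interior_subset).measure_lt_top).ne

/-- A dissection covers only the closure of `Ω`; for an open convex set this identity brings the
interiors of the simplices back into `Ω`. -/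
theorem IsConvexPolytopalDomain.interior_closure (hΩ : IsConvexPolytopalDomain Ω) :
    interior (closure Ω) = Ω := by
  have hne := hΩ.1
  have ho := hΩ.isOpen
  have hc : Convex ℝ Ω := by
    obtain ⟨-, s, rfl⟩ := hΩ
    exact (convex_convexHull ℝ _).interior
  rw [hc.interior_closure_eq_interior_of_nonempty_interior (by rwa [ho.interior_eq]),
    ho.interior_eq]

namespace ReferencePattern

variable {T : SimplicialDissection Ω} (P : ReferencePattern T) {M : ℕ}

theorem _root_.SimplicialDissection.kuhnHomeo_image_subset (T : SimplicialDissection Ω)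
    (hM : 1 ≤ M) (k : Fin T.n) (c : EdgewiseCell d M) :
    kuhnHomeo (T.affineIndependent k) '' kuhnCell M c.1.1 c.1.2 ⊆
      interior (convexHull ℝ (range (T.vertex k))) :=
  (image_mono (kuhnCell_subset hM c)).trans
    (kuhnHomeo_image_subset_interior (T.affineIndependent k))

theorem _root_.SimplicialDissection.interior_subset (T : SimplicialDissection Ω)
    (hΩ : IsConvexPolytopalDomain Ω) (k : Fin T.n) :
    interior (convexHull ℝ (range (T.vertex k))) ⊆ Ω := by
  conv_rhs => rw [← hΩ.interior_closure, ← T.iUnion_eq]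
  exact interior_mono (subset_iUnion (fun k => convexHull ℝ (range (T.vertex k))) k)

theorem _root_.SimplicialDissection.disjoint_kuhnHomeo_image (T : SimplicialDissection Ω)
    (hM : 1 ≤ M) {q q' : Fin T.n × EdgewiseCell d M} (h : q ≠ q') :
    Disjoint (kuhnHomeo (T.affineIndependent q.1) '' kuhnCell M q.2.1.1 q.2.1.2)
      (kuhnHomeo (T.affineIndependent q'.1) '' kuhnCell M q'.2.1.1 q'.2.1.2) := by
  obtain ⟨k, c⟩ := q
  obtain ⟨k', c'⟩ := q'
  by_cases hk : k = k'
  · subst hk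
    rw [disjoint_image_iff (kuhnHomeo _).injective]
    refine disjoint_kuhnCell fun hc => h ?_
    rw [Prod.mk.injEq]
    exact ⟨rfl, Subtype.ext hc⟩
  · exact (T.interior_disjoint hk).mono (T.kuhnHomeo_image_subset hM k c)
      (T.kuhnHomeo_image_subset hM k' c')

theorem support_subset_cell (hM : 1 ≤ M) (c : P.Index M) :
    P.support M c ⊆
      kuhnHomeo (T.affineIndependent c.1.1) '' kuhnCell M c.1.2.1.1 c.1.2.1.2 := by
  have hM0 : (M : ℝ) ≠ 0 := by positivity
  rintro _ ⟨x, hx, rfl⟩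
  obtain ⟨u, hu, rfl⟩ := P.subset_cell _ _ _ hx
  refine ⟨(M : ℝ)⁻¹ • ((fun i => ((c.1.2.1.1 i : ℕ) : ℝ)) + u), ?_, ?_⟩
  · rw [kuhnCell, mem_ofPred_eq]
    convert hu using 1
    ext i
    simp only [Pi.smul_apply, Pi.add_apply, smul_eq_mul]
    field_simp
    ring
  · rw [kuhnHomeo_apply, ← edgeLinearMap_apply, map_smul, map_add]
    rfl

theorem isDeviceFamily_support (hΩ : IsConvexPolytopalDomain Ω) (hM : 1 ≤ M) :
    IsDeviceFamily Ω (P.support M) := by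
  have hM0 : (M : ℝ)⁻¹ ≠ 0 := by positivity
  refine ⟨fun c => ?_, fun c => (P.nonempty _ _ _).image _, fun c => ?_, ?_⟩
  · exact ((isOpenMap_add_left _).comp ((isOpenMap_smul₀ hM0).comp (isOpenMap_add_left _))) _
      (P.isOpen _ _ _)
  · exact (P.support_subset_cell hM c).trans
      ((T.kuhnHomeo_image_subset hM _ _).trans (T.interior_subset hΩ _))
  · rintro ⟨q, j⟩ ⟨q', j'⟩ h
    by_cases hq : q = q'
    · subst hq
      have hj : j ≠ j' := fun e => h (by rw [e])
      refine (disjoint_image_iff ?_).2 (P.disjoint _ _ hj)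
      exact (add_right_injective _).comp
        ((smul_right_injective _ hM0).comp (add_right_injective _))
    · exact (T.disjoint_kuhnHomeo_image hM hq).mono (P.support_subset_cell hM _)
        (P.support_subset_cell hM _)

open Pointwise in
theorem volume_real_support (c : P.Index M) :
    volume.real (P.support M c) = volume.real (P.supp c.1.1 c.1.2.1.2 c.2) / M ^ d := by
  have e : P.support M c = (fun x => T.vertex c.1.1 0 + x) '' ((M : ℝ)⁻¹ •
      ((fun x => edgeMap (T.vertex c.1.1) (fun i => ((c.1.2.1.1 i : ℕ) : ℝ)) + x) ''
        P.supp c.1.1 c.1.2.1.2 c.2)) := by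
    rw [← image_smul, image_image, image_image]
    rfl
  rw [measureReal_def, e, image_add_left, measure_preimage_add, Measure.addHaar_smul,
    image_add_left, measure_preimage_add, ENNReal.toReal_mul, ENNReal.toReal_ofReal (abs_nonneg _),
    finrank_euclideanSpace_fin, measureReal_def, abs_of_nonneg (by positivity), inv_pow]
  ring

theorem isUniformPattern_support (hΩ : IsConvexPolytopalDomain Ω) :
    IsUniformPattern Ω P.support := by
  -- Up to translation and scaling there are only finitely many cells. The constant `c` is a
  -- positive lower bound for the volumes of the first device of each reference cell.
  have hpos : ∀ q : Fin T.n × Equiv.Perm (Fin d),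
      0 < volume.real (P.supp q.1 q.2 ⟨0, P.count_pos q.1 q.2⟩) := by
    intro q
    have hsub : P.supp q.1 q.2 ⟨0, P.count_pos q.1 q.2⟩ ⊆
        edgeEquiv (T.affineIndependent q.1) '' kuhnSimplex q.2 := P.subset_cell _ _ _
    have hbdd : Bornology.IsBounded (kuhnSimplex q.2) :=
      (Metric.isBounded_Icc (0 : Fin d → ℝ) 1).subset fun x hx =>
        ⟨fun i => (hx.1 i).1.le, fun i => (hx.1 i).2.le⟩
    have hbdd' := ((edgeEquiv (T.affineIndependent q.1)).lipschitz.isBounded_image hbdd).subset hsub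
    exact ENNReal.toReal_pos ((P.isOpen _ _ _).measure_pos volume (P.nonempty _ _ _)).ne'
      hbdd'.measure_lt_top.ne
  obtain ⟨c, hc, hcle⟩ := exists_pos_forall_le_of_finite hpos
  refine ⟨fun M hM => P.isDeviceFamily_support hΩ hM,
    ∑ k, ∑ i : Fin d, ‖T.vertex k i.succ - T.vertex k i.castSucc‖, c, by positivity, hc,
    fun M hM => ?_⟩
  refine ⟨Fin T.n × EdgewiseCell d M, inferInstance,
    fun q => kuhnHomeo (T.affineIndependent q.1) '' kuhnCell M q.2.1.1 q.2.1.2,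
    fun q => ⟨q, ⟨0, P.count_pos _ _⟩⟩,
    fun q => (kuhnHomeo _).isOpenMap _ isOpen_kuhnCell,
    fun q => convex_kuhnCell.kuhnHomeo_image _,
    fun q => (T.kuhnHomeo_image_subset hM _ _).trans (T.interior_subset hΩ _),
    fun q q' h => T.disjoint_kuhnHomeo_image hM h, ?_, ?_,
    fun q => P.support_subset_cell hM _, fun q => ?_⟩
  · refine measure_mono_null ?_ (measure_iUnion_null fun k =>
      volume_convexHull_diff_cells (T.affineIndependent k) hM)
    rintro x ⟨hx, hxc⟩
    have hx' := subset_closure hx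
    rw [← T.iUnion_eq] at hx'
    obtain ⟨k, hk⟩ := mem_iUnion.1 hx'
    refine mem_iUnion.2 ⟨k, hk, fun h => hxc ?_⟩
    obtain ⟨e, he⟩ := mem_iUnion.1 h
    exact mem_iUnion.2 ⟨(k, e), he⟩
  · rintro ⟨k, e⟩ _ ⟨x, hx, rfl⟩ _ ⟨y, hy, rfl⟩
    have h1 := norm_edgeMap_le (T.vertex k) (x := y - x) (abs_sub_le_of_mem_kuhnCell hM hx hy)
    simp only [kuhnHomeo_apply]
    rw [← edgeLinearMap_apply, map_sub, edgeLinearMap_apply, edgeLinearMap_apply] at h1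
    rw [add_sub_add_left_eq_sub]
    refine h1.trans ?_
    rw [one_div, inv_mul_eq_div]
    gcongr
    exact Finset.single_le_sum
      (f := fun k => ∑ i : Fin d, ‖T.vertex k i.succ - T.vertex k i.castSucc‖)
      (fun k _ => Finset.sum_nonneg fun i _ => norm_nonneg _) (Finset.mem_univ k)
  · rw [P.volume_real_support]
    gcongr
    exact hcle (q.1, q.2.1.2)

end ReferencePattern
end RescaledCopies

theorem mainTheorem2 (d : ℕ) (hd : 0 < d) (ν : ℝ) (hν : 0 < ν) (bc : BoundaryCondition) :
    -- the chessboard pattern in a rectangle: actuators in the squares of one colour, sensors in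
    -- the squares of the other colour
    (∀ (a b : Fin d → ℝ), (∀ i, a i < b i) → ∀ p : ChessPlacement d,
      ExplicitOperatorsSatisfyAssumption (openRect a b) bc ν
        (chessSupport a b p 0) (chessSupport a b p 1)) ∧
    -- rescaled copies of reference patterns in a general convex polygonal domain
    (∀ Ω : Set (Eucl d), IsConvexPolytopalDomain Ω →
      ∀ (T : SimplicialDissection Ω) (P Q : ReferencePattern T),
        ExplicitOperatorsSatisfyAssumption Ω bc ν P.support Q.support) := by
  refine ⟨fun a b hab p => ?_, fun Ω hΩ T P Q => ?_⟩
  · obtain ⟨e, he⟩ := exists_chess_parity_one hd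
    exact (isUniformPattern_chessSupport hab p ⟨0, by simp⟩).explicitOperatorsSatisfyAssumption
      (isUniformPattern_chessSupport hab p ⟨e, he⟩) (isOpen_openRect a b)
      (volume_openRect_ne_top a b) hν
  · exact (P.isUniformPattern_support hΩ).explicitOperatorsSatisfyAssumption
      (Q.isUniformPattern_support hΩ) hΩ.isOpen hΩ.volume_ne_top hν
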